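/- **Theorem (Bias and variance of the Bernstein c.d.f. estimator on the simplex).** Let $\mathcal S=\{x\in[0,1]^d:\sum_{i=1}^d x_i\le 1\}$ and $\mathrm{Int}(\mathcal S)=\{x\in(0,1)^d:\sum_{i=1}^d x_i<1\}$. Let $X_1,X_2,\dots$ be independent random vectors in $\mathbb R^d$ with common cumulative distribution function $F(x)=\mathbb P(X_1\le x)$ (componentwise inequality), and assume that $F$ is twice continuously differentiable on $\mathcal S$ (with derivatives at boundary points taken within $\mathcal S$). For $n,m\in\mathbb N$ and $x\in\mathcal S$ let $F_n(x)=n^{-1}\sum_{i=1}^n\mathbf 1_{\{X_i\le x\}}$ be the empirical c.d.f. and $$F^\star_{n,m}(x)=\sum_{k\in\mathbb N_0^d,\ \|k\|_1\le m}F_n(k/m)\,P_{k,m}(x),\qquad P_{k,m}(x)=\frac{m!}{(m-\|k\|_1)!\prod_{i=1}^d k_i!}\,(1-\|x\|_1)^{m-\|k\|_1}\prod_{i=1}^d x_i^{k_i},$$ the Bernstein estimator of $F$ of order $m$. Put $$B(x)=\tfrac12\sum_{i,j=1}^d\big(x_i\mathbf 1_{\{i=j\}}-x_ix_j\big)\frac{\partial^2F}{\partial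 x_i\partial x_j}(x),\qquad V(x)=\sum_{i=1}^d\frac{\partial F}{\partial x_i}(x)\sqrt{\frac{x_i(1-x_i)}{\pi}} .$$ Let $m=m(n)\in\mathbb N$ be any sequence with $m(n)\to\infty$ as $n\to\infty$. Then, as $n\to\infty$, $$\mathbb E[F^\star_{n,m}(x)]-F(x)=m^{-1}B(x)+o(m^{-1})\quad\text{uniformly in }x\in\mathcal S,$$ and, for every $x\in\mathrm{Int}(\mathcal S)$, $$\mathrm{Var}\big(F^\star_{n,m}(x)\big)=n^{-1}F(x)(1-F(x))-n^{-1}m^{-1/2}V(x)+o_x(n^{-1}m^{-1/2}),$$ where the last error term may depend on $x$. -/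

import Mathlib

open MeasureTheory ProbabilityTheory Filter Asymptotics
open scoped Topology Nat

noncomputable section

namespace BernsteinSimplex

/-- The `d`-dimensional unit simplex `{x ∈ [0,1]^d : ‖x‖₁ ≤ 1}`. (The upper bounds `x i ≤ 1`
follow from the two conditions, and `‖x‖₁ = ∑ x i` as the coordinates are nonnegative.) -/
def simplex (d : ℕ) : Set (Fin d → ℝ) :=
  {x | (∀ i, 0 ≤ x i) ∧ ∑ i, x i ≤ 1}

/-- The interior of the simplex, `{x ∈ (0,1)^d : ‖x‖₁ < 1}`. -/
def simplexInterior (d : ℕ) : Set (Fin d → ℝ) :=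
  {x | (∀ i, 0 < x i) ∧ ∑ i, x i < 1}

/-- The joint cumulative distribution function `x ↦ μ((-∞, x])` of a law `μ` on `ℝ^d`;
the order on `Fin d → ℝ` is the componentwise one. -/
def jointCDF {d : ℕ} (μ : Measure (Fin d → ℝ)) (x : Fin d → ℝ) : ℝ :=
  μ.real (Set.Iic x)

/-- The finite set `ℕ₀^d ∩ m𝒮` of multi-indices `k` with `k₁ + ⋯ + k_d ≤ m`. -/
def multiIndices (d m : ℕ) : Finset (Fin d → ℕ) :=
  (Fintype.piFinset fun _ : Fin d => Finset.range (m + 1)).filter fun k => ∑ i, k i ≤ m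

theorem mem_multiIndices {d m : ℕ} {k : Fin d → ℕ} :
    k ∈ multiIndices d m ↔ ∑ i, k i ≤ m := by
  unfold multiIndices
  simp only [Finset.mem_filter, Fintype.mem_piFinset, Finset.mem_range, and_iff_right_iff_imp]
  intro h i
  exact Nat.lt_succ_of_le ((Finset.single_le_sum (fun j _ => Nat.zero_le (k j))
    (Finset.mem_univ i)).trans h)

/-- The multinomial weight `P_{k,m}(x)`, for `k ∈ ℕ₀^d ∩ m𝒮`. -/
def multinomialWeight {d : ℕ} (m : ℕ) (k : Fin d → ℕ) (x : Fin d → ℝ) : ℝ :=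
  (m ! : ℝ) / (((m - ∑ i, k i)! : ℝ) * ∏ i, ((k i)! : ℝ)) *
    (1 - ∑ i, x i) ^ (m - ∑ i, k i) * ∏ i, x i ^ k i

/-- The Bernstein polynomial of order `m` of a function `G` on the simplex. -/
def bernsteinPolynomial {d : ℕ} (m : ℕ) (G : (Fin d → ℝ) → ℝ) (x : Fin d → ℝ) : ℝ :=
  ∑ k ∈ multiIndices d m, G (fun i => (k i : ℝ) / m) * multinomialWeight m k x

/-- The empirical c.d.f. of the first `n` observations `X 0 ω, …, X (n - 1) ω`. -/
def empiricalCDF {d : ℕ} {Ω : Type*} (X : ℕ → Ω → Fin d → ℝ) (n : ℕ) (ω : Ω)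
    (x : Fin d → ℝ) : ℝ :=
  (n : ℝ)⁻¹ * ∑ i ∈ Finset.range n, (Set.Iic x).indicator (fun _ => (1 : ℝ)) (X i ω)

/-- The Bernstein c.d.f. estimator: the Bernstein polynomial of order `m` of the empirical
c.d.f. of the first `n` observations. -/
def bernsteinEstimator {d : ℕ} {Ω : Type*} (X : ℕ → Ω → Fin d → ℝ) (n m : ℕ)
    (x : Fin d → ℝ) (ω : Ω) : ℝ :=
  bernsteinPolynomial m (empiricalCDF X n ω) x

/-- The partial derivative `∂F/∂x_i` of a function on the simplex, taken within the simplex;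
at an interior point this is the usual partial derivative. -/
def partialDeriv {d : ℕ} (i : Fin d) (F : (Fin d → ℝ) → ℝ) (x : Fin d → ℝ) : ℝ :=
  fderivWithin ℝ F (simplex d) x (Pi.single i 1)

/-- The function
`B(x) = (1/2) ∑_{i,j} (x_i 1_{i = j} - x_i x_j) ∂²F/∂x_i∂x_j (x)`. -/
def biasTerm {d : ℕ} (F : (Fin d → ℝ) → ℝ) (x : Fin d → ℝ) : ℝ :=
  (1 / 2 : ℝ) * ∑ i, ∑ j, ((if i = j then x i else 0) - x i * x j) *
    partialDeriv i (partialDeriv j F) x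

/-- The function `V(x) = ∑_i ∂F/∂x_i (x) √(x_i (1 - x_i) / π)`. -/
def varianceTerm {d : ℕ} (F : (Fin d → ℝ) → ℝ) (x : Fin d → ℝ) : ℝ :=
  ∑ i, partialDeriv i F x * Real.sqrt (x i * (1 - x i) / Real.pi)

end BernsteinSimplex

end

noncomputable section

namespace BernsteinSimplex

variable {d : ℕ}

/-! Write E for expectation over a multinomial index k with parameters m and x (`multinomialMean`),
and let l be an independent copy of k. The estimator is an average of n i.i.d. terms, so its mean is
exactly E F(k/m), and its variance is exactly n⁻¹ (E F(k/m ∧ l/m) − (E F(k/m))²), with ∧ the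
componentwise minimum (`integral_bernsteinEstimator`, `variance_bernsteinEstimator`).

Bias: expand F to second order at x. The linear term has mean zero and the covariance of k/m turns
the quadratic term into B(x)/m. By uniform continuity of the second derivatives on the compact
simplex, the remainder is at most ε|y − x|² + C|y − x|⁴ with C independent of x; the second and
fourth moments make it uniformly o(1/m) (`exists_taylor_two`,
`eventually_abs_bernsteinPolynomial_sub_le`).

Variance: expand F(k/m ∧ l/m) to first order and use min(a, b) = (a + b)/2 − |a − b|/2. What
survives at order m^(-1/2) is E|k_i − l_i|/√m, whose limit is 2√(x_i(1 − x_i)/π)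
(`tendsto_multinomialMean_abs_sub`). This limit comes from writing |s| as a multiple of ∫ (1 −
cos(st))/t² dt: the expectation of the cosine is an explicit m-th power converging to a Gaussian
characteristic function, dominated convergence applies, and the limiting integral is recognised
through the absolute moment of a Gaussian. -/

/-- The expectation of `G` under the multinomial distribution with weights `P_{k,m}(x)`. -/
def multinomialMean (m : ℕ) (x : Fin d → ℝ) (G : (Fin d → ℕ) → ℝ) : ℝ :=
  ∑ k ∈ multiIndices d m, G k * multinomialWeight m k x

/-! ### Multinomial expectations: linearity, positivity, recursion in m. -/

theorem bernsteinPolynomial_eq (m : ℕ) (G : (Fin d → ℝ) → ℝ) (x : Fin d → ℝ) :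
    bernsteinPolynomial m G x = multinomialMean m x fun k => G fun i => (k i : ℝ) / m := rfl

theorem multinomialMean_add (m : ℕ) (x : Fin d → ℝ) (G H : (Fin d → ℕ) → ℝ) :
    multinomialMean m x (fun k => G k + H k) = multinomialMean m x G + multinomialMean m x H := by
  simp [multinomialMean, add_mul, Finset.sum_add_distrib]

theorem multinomialMean_sub (m : ℕ) (x : Fin d → ℝ) (G H : (Fin d → ℕ) → ℝ) :
    multinomialMean m x (fun k => G k - H k) = multinomialMean m x G - multinomialMean m x H := by
  simp [multinomialMean, sub_mul, Finset.sum_sub_distrib]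

theorem multinomialMean_const_mul (m : ℕ) (x : Fin d → ℝ) (c : ℝ) (G : (Fin d → ℕ) → ℝ) :
    multinomialMean m x (fun k => c * G k) = c * multinomialMean m x G := by
  simp [multinomialMean, Finset.mul_sum, mul_assoc]

theorem multinomialMean_sum {ι : Type*} (s : Finset ι) (m : ℕ) (x : Fin d → ℝ)
    (G : ι → (Fin d → ℕ) → ℝ) :
    multinomialMean m x (fun k => ∑ i ∈ s, G i k) = ∑ i ∈ s, multinomialMean m x (G i) := by
  simp only [multinomialMean, Finset.sum_mul]
  exact Finset.sum_comm

theorem multinomialMean_zero (x : Fin d → ℝ) (G : (Fin d → ℕ) → ℝ) :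
    multinomialMean 0 x G = G 0 := by
  have h : multiIndices d 0 = {0} := by
    ext k
    simp [mem_multiIndices, funext_iff]
  simp [multinomialMean, h, multinomialWeight]

theorem multinomialWeight_nonneg {x : Fin d → ℝ} (hx : x ∈ simplex d) (m : ℕ) (k : Fin d → ℕ) :
    0 ≤ multinomialWeight m k x := by
  unfold multinomialWeight
  have h1 := hx.1
  have h2 : 0 ≤ 1 - ∑ i, x i := sub_nonneg.2 hx.2
  have h3 : 0 ≤ ∏ i, x i ^ k i := Finset.prod_nonneg fun i _ => pow_nonneg (h1 i) _
  positivity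

theorem multinomialMean_mono {x : Fin d → ℝ} (hx : x ∈ simplex d) {m : ℕ}
    {G H : (Fin d → ℕ) → ℝ} (h : ∀ k ∈ multiIndices d m, G k ≤ H k) :
    multinomialMean m x G ≤ multinomialMean m x H :=
  Finset.sum_le_sum fun k hk => mul_le_mul_of_nonneg_right (h k hk) (multinomialWeight_nonneg hx m k)

theorem abs_multinomialMean_le {x : Fin d → ℝ} (hx : x ∈ simplex d) {m : ℕ}
    {G H : (Fin d → ℕ) → ℝ} (h : ∀ k ∈ multiIndices d m, |G k| ≤ H k) :
    |multinomialMean m x G| ≤ multinomialMean m x H := by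
  refine (Finset.abs_sum_le_sum_abs _ _).trans (Finset.sum_le_sum fun k hk => ?_)
  rw [abs_mul, abs_of_nonneg (multinomialWeight_nonneg hx m k)]
  exact mul_le_mul_of_nonneg_right (h k hk) (multinomialWeight_nonneg hx m k)

theorem sub_sum_mul_multinomialWeight_succ (m : ℕ) (k : Fin d → ℕ) (x : Fin d → ℝ)
    (hk : ∑ i, k i ≤ m) :
    ((m : ℝ) + 1 - ∑ i, (k i : ℝ)) * multinomialWeight (m + 1) k x =
      (m + 1) * ((1 - ∑ i, x i) * multinomialWeight m k x) := by
  obtain ⟨r, rfl⟩ := Nat.exists_eq_add_of_le hk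
  have h1 : ∑ i, k i + r + 1 - ∑ i, k i = r + 1 := by omega
  have h2 : ∑ i, k i + r - ∑ i, k i = r := by omega
  unfold multinomialWeight
  rw [h1, h2, Nat.factorial_succ, Nat.factorial_succ r]
  have hp : (∏ i, ((k i)! : ℝ)) ≠ 0 := Finset.prod_ne_zero_iff.2 fun i _ => by positivity
  have hr : (r ! : ℝ) ≠ 0 := by positivity
  have hr' : (r : ℝ) + 1 ≠ 0 := by positivity
  push_cast
  field_simp
  ring

theorem mul_multinomialWeight_add_single (m : ℕ) (k : Fin d → ℕ) (x : Fin d → ℝ)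
    (j : Fin d) :
    ((k j : ℝ) + 1) * multinomialWeight (m + 1) (k + Pi.single j 1) x =
      (m + 1) * (x j * multinomialWeight m k x) := by
  have hs : ∑ i, (k + Pi.single j 1 : Fin d → ℕ) i = ∑ i, k i + 1 := by
    simp [Finset.sum_add_distrib]
  have h1 : ∏ i, (((k + Pi.single j 1 : Fin d → ℕ) i)! : ℝ) = (k j + 1) * ∏ i, ((k i)! : ℝ) := by
    rw [← Finset.mul_prod_erase _ _ (Finset.mem_univ j),
      ← Finset.mul_prod_erase _ (fun i => ((k i)! : ℝ)) (Finset.mem_univ j), ← mul_assoc]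
    congr 1
    · simp [Nat.factorial_succ]
    · refine Finset.prod_congr rfl fun i hi => ?_
      simp [Finset.ne_of_mem_erase hi]
  have h2 : ∏ i, x i ^ ((k + Pi.single j 1 : Fin d → ℕ) i) = x j * ∏ i, x i ^ k i := by
    simp only [Pi.add_apply, pow_add, Finset.prod_mul_distrib]
    rw [mul_comm, Finset.prod_eq_single j]
    · simp
    · intro b _ hb
      simp [hb]
    · simp
  have hp : (∏ i, ((k i)! : ℝ)) ≠ 0 := Finset.prod_ne_zero_iff.2 fun i _ => by positivity
  have hj : (k j : ℝ) + 1 ≠ 0 := by positivity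
  unfold multinomialWeight
  rw [hs, h1, h2, Nat.add_sub_add_right, Nat.factorial_succ]
  push_cast
  field_simp

/-- Conditioning on one additional trial: it hits cell j with weight `x j` and the residual cell
with weight `1 - ∑ x i`. This is an algebraic identity for every real `x`; all moments below follow
from it by induction on `m`. -/
theorem multinomialMean_succ (m : ℕ) (x : Fin d → ℝ) (G : (Fin d → ℕ) → ℝ) :
    multinomialMean (m + 1) x G = multinomialMean m x fun k =>
      (1 - ∑ i, x i) * G k + ∑ j, x j * G (k + Pi.single j 1) := by
  have hm : (m : ℝ) + 1 ≠ 0 := by positivity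
  -- Split m + 1 = (m + 1 − |k|) + ∑ k_j inside the sum; by the two absorption identities above,
  -- each piece lowers the order of the weight by one.
  have key : ((m : ℝ) + 1) * multinomialMean (m + 1) x G =
      ∑ k ∈ multiIndices d (m + 1), G k *
        (((m : ℝ) + 1 - ∑ i, (k i : ℝ)) * multinomialWeight (m + 1) k x) +
      ∑ j, ∑ k ∈ multiIndices d (m + 1), G k * ((k j : ℝ) * multinomialWeight (m + 1) k x) := by
    rw [Finset.sum_comm, ← Finset.sum_add_distrib, multinomialMean, Finset.mul_sum]
    refine Finset.sum_congr rfl fun k _ => ?_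
    rw [← Finset.mul_sum, ← Finset.sum_mul]
    ring
  have h0 : ∑ k ∈ multiIndices d (m + 1), G k *
        (((m : ℝ) + 1 - ∑ i, (k i : ℝ)) * multinomialWeight (m + 1) k x) =
      (m + 1) * multinomialMean m x fun k => (1 - ∑ i, x i) * G k := by
    rw [multinomialMean, Finset.mul_sum]
    symm
    refine Finset.sum_subset_zero_on_sdiff (fun k hk => ?_) (fun k hk => ?_) (fun k hk => ?_)
    · rw [mem_multiIndices] at hk ⊢
      omega
    · simp only [Finset.mem_sdiff, mem_multiIndices] at hk
      have h : ∑ i, k i = m + 1 := by omega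
      have h' : ∑ i, (k i : ℝ) = m + 1 := by exact_mod_cast h
      rw [h']
      ring
    · rw [sub_sum_mul_multinomialWeight_succ m k x (mem_multiIndices.1 hk)]
      ring
  have hj : ∀ j, ∑ k ∈ multiIndices d (m + 1), G k *
        ((k j : ℝ) * multinomialWeight (m + 1) k x) =
      (m + 1) * multinomialMean m x fun k => x j * G (k + Pi.single j 1) := by
    intro j
    rw [multinomialMean, Finset.mul_sum]
    symm
    refine Finset.sum_of_injOn (fun k => k + Pi.single j 1) (fun a _ b _ h => ?_)
      (fun k hk => ?_) (fun k hk hk' => ?_) (fun k hk => ?_)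
    · exact add_right_cancel h
    · simp only [Finset.mem_coe, mem_multiIndices] at hk ⊢
      simp [Finset.sum_add_distrib, hk]
    -- The indices missed by the shift by e_j are those with k_j = 0, where the factor k_j kills the
    -- term.
    · have h0 : k j = 0 := by
        by_contra h
        have hle : Pi.single j 1 ≤ k := by
          intro i
          by_cases hi : i = j
          · subst hi
            simp
            omega
          · simp [hi]
        refine hk' ⟨k - Pi.single j 1, ?_, tsub_add_cancel_of_le hle⟩
        simp only [Finset.mem_coe, mem_multiIndices] at hk ⊢
        have := congrArg (fun f : Fin d → ℕ => ∑ i, f i) (tsub_add_cancel_of_le hle)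
        simp only [Pi.add_apply, Finset.sum_add_distrib] at this
        simp at this
        simp
        omega
      simp [h0]
    · have := mul_multinomialWeight_add_single m k x j
      have h1 : (((k + Pi.single j 1 : Fin d → ℕ) j : ℕ) : ℝ) = k j + 1 := by simp
      rw [h1, this]
      ring
  rw [h0] at key
  simp only [hj, ← Finset.mul_sum, ← mul_add] at key
  rw [multinomialMean_add, multinomialMean_sum]
  exact mul_left_cancel₀ hm key

theorem multinomialMean_const (m : ℕ) (x : Fin d → ℝ) (c : ℝ) :
    multinomialMean m x (fun _ => c) = c := by
  induction m with
  | zero => rw [multinomialMean_zero]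
  | succ m ih =>
    rw [multinomialMean_succ, ← Finset.sum_mul, ← add_mul]
    simpa using ih

/-- The recursion for functions of one coordinate. -/
theorem multinomialMean_succ_apply (m : ℕ) (x : Fin d → ℝ) (i : Fin d) (g : ℕ → ℝ) :
    multinomialMean (m + 1) x (fun k => g (k i)) =
      multinomialMean m x fun k => (1 - x i) * g (k i) + x i * g (k i + 1) := by
  rw [multinomialMean_succ]
  congr 1
  ext k
  have h : ∀ j, x j * g ((k + Pi.single j 1 : Fin d → ℕ) i) =
      x j * g (k i) + if j = i then x i * (g (k i + 1) - g (k i)) else 0 := by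
    intro j
    by_cases hj : j = i
    · subst hj
      simp
      ring
    · simp [hj, Ne.symm hj]
  simp only [h, Finset.sum_add_distrib, ← Finset.sum_mul]
  simp
  ring

/-! ### Moments and characteristic functions of the coordinates. -/

theorem multinomialMean_centered (m : ℕ) (x : Fin d → ℝ) (i : Fin d) :
    multinomialMean m x (fun k => (k i : ℝ) - m * x i) = 0 := by
  induction m with
  | zero => simp [multinomialMean_zero]
  | succ m ih =>
    rw [multinomialMean_succ_apply m x i fun a => (a : ℝ) - (m + 1 : ℕ) * x i, ← ih]
    congr 1
    ext k
    push_cast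
    ring

theorem multinomialMean_covariance (m : ℕ) (x : Fin d → ℝ) (i j : Fin d) :
    multinomialMean m x (fun k => ((k i : ℝ) - m * x i) * ((k j : ℝ) - m * x j)) =
      m * ((if i = j then x i else 0) - x i * x j) := by
  induction m with
  | zero => simp [multinomialMean_zero]
  | succ m ih =>
    rw [multinomialMean_succ]
    have : (fun k : Fin d → ℕ => (1 - ∑ i, x i) *
          (((k i : ℝ) - (m + 1 : ℕ) * x i) * ((k j : ℝ) - (m + 1 : ℕ) * x j)) +
        ∑ l, x l * ((((k + Pi.single l 1 : Fin d → ℕ) i : ℕ) - (m + 1 : ℕ) * x i) *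
          (((k + Pi.single l 1 : Fin d → ℕ) j : ℕ) - (m + 1 : ℕ) * x j))) =
        fun k => ((k i : ℝ) - m * x i) * ((k j : ℝ) - m * x j) +
          ((if i = j then x i else 0) - x i * x j) := by
      ext k
      -- A trial in cell l raises the first factor only if i = l and the second only if j = l; the
      -- last summand is the product of both increments.
      have h : ∀ l, x l * ((((k + Pi.single l 1 : Fin d → ℕ) i : ℕ) - (m + 1 : ℕ) * x i) *
          (((k + Pi.single l 1 : Fin d → ℕ) j : ℕ) - (m + 1 : ℕ) * x j)) =
          x l * (((k i : ℝ) - (m + 1 : ℕ) * x i) * ((k j : ℝ) - (m + 1 : ℕ) * x j)) +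
          ((if i = l then x i * ((k j : ℝ) - (m + 1 : ℕ) * x j) else 0) +
          ((if j = l then x j * ((k i : ℝ) - (m + 1 : ℕ) * x i) else 0) +
          (if i = l then (if i = j then x i else 0) else 0))) := by
        intro l
        simp only [Pi.add_apply, Pi.single_apply, Nat.cast_add]
        by_cases h1 : i = l
        · subst h1
          by_cases h2 : j = i
          · subst h2
            simp
            ring
          · simp [h2, Ne.symm h2]
            ring
        · by_cases h2 : j = l
          · subst h2
            simp [h1]
            ring
          · simp [h1, h2]
      simp only [h, Finset.sum_add_distrib, ← Finset.sum_mul, Finset.sum_ite_eq, Finset.mem_univ,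
        if_true]
      push_cast
      ring
    rw [this, multinomialMean_add, ih, multinomialMean_const]
    push_cast
    ring

theorem multinomialMean_sq (m : ℕ) (x : Fin d → ℝ) (i : Fin d) :
    multinomialMean m x (fun k => ((k i : ℝ) - m * x i) ^ 2) = m * (x i * (1 - x i)) := by
  simp only [sq, multinomialMean_covariance, if_true]
  ring

theorem apply_le_one {x : Fin d → ℝ} (hx : x ∈ simplex d) (i : Fin d) : x i ≤ 1 :=
  (Finset.single_le_sum (fun j _ => hx.1 j) (Finset.mem_univ i)).trans hx.2

theorem multinomialMean_sq_le {x : Fin d → ℝ} (hx : x ∈ simplex d) (m : ℕ) (i : Fin d) :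
    multinomialMean m x (fun k => ((k i : ℝ) - m * x i) ^ 2) ≤ m := by
  rw [multinomialMean_sq]
  have h0 := hx.1 i
  exact mul_le_of_le_one_right (Nat.cast_nonneg m) (by nlinarith [apply_le_one hx i])

theorem multinomialMean_pow_four_le {x : Fin d → ℝ} (hx : x ∈ simplex d) (m : ℕ) (i : Fin d) :
    multinomialMean m x (fun k => ((k i : ℝ) - m * x i) ^ 4) ≤ 6 * (m : ℝ) ^ 2 := by
  have h0 := hx.1 i
  have h1 := apply_le_one hx i
  have hp0 : 0 ≤ x i * (1 - x i) := mul_nonneg h0 (sub_nonneg.2 h1)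
  have hp1 : x i * (1 - x i) ≤ 1 := by nlinarith
  induction m with
  | zero => simp [multinomialMean_zero]
  | succ m ih =>
    rw [multinomialMean_succ_apply m x i fun a => ((a : ℝ) - (m + 1 : ℕ) * x i) ^ 4]
    -- The cubic term is absent because one centred trial has mean zero; the linear term vanishes on
    -- averaging. The bound 6m² then survives the induction since the increment is at most 6m + 1.
    have : (fun k : Fin d → ℕ => (1 - x i) * ((k i : ℝ) - (m + 1 : ℕ) * x i) ^ 4 +
        x i * (((k i + 1 : ℕ) : ℝ) - (m + 1 : ℕ) * x i) ^ 4) = fun k =>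
        ((k i : ℝ) - m * x i) ^ 4 + (6 * (x i * (1 - x i)) * ((k i : ℝ) - m * x i) ^ 2 +
          (4 * (x i * (1 - x i) * (1 - 2 * x i)) * ((k i : ℝ) - m * x i) +
            x i * (1 - x i) * ((1 - x i) ^ 3 + x i ^ 3))) := by
      ext k
      push_cast
      ring
    rw [this, multinomialMean_add, multinomialMean_add, multinomialMean_add,
      multinomialMean_const_mul, multinomialMean_const_mul, multinomialMean_centered,
      multinomialMean_const, multinomialMean_sq]
    have h3 : (1 - x i) ^ 3 + x i ^ 3 ≤ 1 := by nlinarith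
    have h4 : x i * (1 - x i) * ((1 - x i) ^ 3 + x i ^ 3) ≤ 1 :=
      mul_le_one₀ hp1 (by have := sub_nonneg.2 h1; positivity) h3
    have h5 : 6 * (x i * (1 - x i)) * (m * (x i * (1 - x i))) ≤ 6 * m := by
      have : x i * (1 - x i) * (x i * (1 - x i)) ≤ 1 := mul_le_one₀ hp1 hp0 hp1
      have hm : (0 : ℝ) ≤ m := Nat.cast_nonneg m
      nlinarith
    push_cast
    nlinarith

/-- Squared modulus of the characteristic function of a binomial variable: |1 − x + x e^{it}|² = 1 −
2x(1 − x)(1 − cos t), raised to the power m. Working with cosine and sine separately avoids complex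
numbers. -/
theorem multinomialMean_cos_sq_add_sin_sq (m : ℕ) (x : Fin d → ℝ) (i : Fin d) (t : ℝ) :
    multinomialMean m x (fun k => Real.cos (t * k i)) ^ 2 +
      multinomialMean m x (fun k => Real.sin (t * k i)) ^ 2 =
      (1 - 2 * (x i * (1 - x i)) * (1 - Real.cos t)) ^ m := by
  induction m with
  | zero => simp [multinomialMean_zero]
  | succ m ih =>
    rw [multinomialMean_succ_apply m x i fun a => Real.cos (t * a),
      multinomialMean_succ_apply m x i fun a => Real.sin (t * a), pow_succ _ m, ← ih]
    have hc : (fun k : Fin d → ℕ => (1 - x i) * Real.cos (t * k i) +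
        x i * Real.cos (t * ((k i + 1 : ℕ) : ℝ))) = fun k =>
        (1 - x i + x i * Real.cos t) * Real.cos (t * k i) -
          (x i * Real.sin t) * Real.sin (t * k i) := by
      ext k
      push_cast
      rw [mul_add, mul_one, Real.cos_add]
      ring
    have hs : (fun k : Fin d → ℕ => (1 - x i) * Real.sin (t * k i) +
        x i * Real.sin (t * ((k i + 1 : ℕ) : ℝ))) = fun k =>
        (1 - x i + x i * Real.cos t) * Real.sin (t * k i) +
          (x i * Real.sin t) * Real.cos (t * k i) := by
      ext k
      push_cast
      rw [mul_add, mul_one, Real.sin_add]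
      ring
    rw [hc, hs, multinomialMean_sub, multinomialMean_add]
    simp only [multinomialMean_const_mul]
    linear_combination (multinomialMean m x (fun k => Real.cos (t * k i)) ^ 2 +
      multinomialMean m x (fun k => Real.sin (t * k i)) ^ 2) * x i ^ 2 * Real.sin_sq_add_cos_sq t

theorem multinomialMean_cos_sub (m : ℕ) (x : Fin d → ℝ) (i : Fin d) (t : ℝ) :
    multinomialMean m x (fun k => multinomialMean m x fun l =>
      Real.cos (t * ((k i : ℝ) - l i))) =
      (1 - 2 * (x i * (1 - x i)) * (1 - Real.cos t)) ^ m := by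
  rw [← multinomialMean_cos_sq_add_sin_sq]
  simp only [mul_sub, Real.cos_sub, multinomialMean_add, multinomialMean_const_mul]
  simp only [mul_comm (Real.cos _), mul_comm (Real.sin _), multinomialMean_const_mul]
  ring

/-! ### The absolute value as a cosine integral, and its Gaussian mean. -/

theorem one_sub_div_sq_le {a A t : ℝ} (h0 : 0 ≤ A) (h2 : 1 - a ≤ 2) (hA : 1 - a ≤ A * t ^ 2) :
    (1 - a) / t ^ 2 ≤ (2 + A) * (1 + t ^ 2)⁻¹ := by
  rcases eq_or_ne t 0 with rfl | ht
  · simp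
    linarith
  · have : 0 < t ^ 2 := by positivity
    -- In (1 − a)(1 + t²) the first summand is bounded by A t² and the second by 2t². The resulting
    -- integrable majorant also serves the dominated convergence below.
    rw [← div_eq_mul_inv, div_le_div_iff₀ this (by positivity)]
    nlinarith

theorem one_sub_cos_div_sq_nonneg (s t : ℝ) : 0 ≤ (1 - Real.cos (s * t)) / t ^ 2 :=
  div_nonneg (sub_nonneg.2 (Real.cos_le_one _)) (sq_nonneg t)

theorem integrable_one_sub_cos_div_sq (s : ℝ) :
    Integrable fun t : ℝ => (1 - Real.cos (s * t)) / t ^ 2 := by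
  refine (integrable_inv_one_add_sq.const_mul (2 + s ^ 2 / 2)).mono'
    (Measurable.aestronglyMeasurable (by fun_prop)) (Eventually.of_forall fun t => ?_)
  rw [Real.norm_of_nonneg (one_sub_cos_div_sq_nonneg s t)]
  refine one_sub_div_sq_le (by positivity) (by linarith [Real.neg_one_le_cos (s * t)]) ?_
  have := Real.one_sub_sq_div_two_le_cos (x := s * t)
  nlinarith

/-- The constant `∫ (1 - cos t) / t² dt`. -/
def cosKernelMass : ℝ := ∫ t : ℝ, (1 - Real.cos t) / t ^ 2

/-- The constant occurs on both sides of the final identification and cancels, so only its being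
nonzero matters, not its value. -/
theorem cosKernelMass_pos : 0 < cosKernelMass := by
  have hi : Integrable fun t : ℝ => (1 - Real.cos t) / t ^ 2 := by
    simpa using integrable_one_sub_cos_div_sq 1
  have hn : ∀ t : ℝ, 0 ≤ (1 - Real.cos t) / t ^ 2 := fun t => by
    simpa using one_sub_cos_div_sq_nonneg 1 t
  rw [cosKernelMass, integral_pos_iff_support_of_nonneg hn hi]
  refine lt_of_lt_of_le ?_ (measure_mono (s := Set.Ioo (0 : ℝ) 1) fun t ht => ?_)
  · simp
  · have h1 : Real.cos t < 1 := by
      rw [← Real.cos_zero]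
      exact Real.cos_lt_cos_of_nonneg_of_le_pi le_rfl (by linarith [ht.2, Real.pi_gt_three]) ht.1
    have := ht.1
    exact (div_pos (sub_pos.2 h1) (by positivity)).ne'

/-- Substitution u = st. Averaging over s reduces absolute moments to characteristic functions. -/
theorem integral_one_sub_cos_div_sq (s : ℝ) :
    ∫ t : ℝ, (1 - Real.cos (s * t)) / t ^ 2 = cosKernelMass * |s| := by
  rcases eq_or_ne s 0 with rfl | hs
  · simp
  · have h : (fun t : ℝ => (1 - Real.cos (s * t)) / t ^ 2) =
        fun t => s ^ 2 * ((fun u : ℝ => (1 - Real.cos u) / u ^ 2) (s * t)) := by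
      ext t
      rcases eq_or_ne t 0 with rfl | ht
      · simp
      · field_simp
    rw [h, integral_const_mul, Measure.integral_comp_mul_left (fun u : ℝ => (1 - Real.cos u) / u ^ 2) s, smul_eq_mul,
      ← cosKernelMass, abs_inv, ← sq_abs]
    have : |s| ≠ 0 := abs_ne_zero.2 hs
    field_simp

theorem integral_cos_gaussianReal (v : NNReal) (t : ℝ) :
    ∫ z, Real.cos (z * t) ∂gaussianReal 0 v = Real.exp (-(v * t ^ 2 / 2)) := by
  have h := charFun_gaussianReal (μ := 0) (v := v) t
  rw [charFun_apply_real] at h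
  have hi : Integrable (fun z : ℝ => Complex.exp (t * z * Complex.I)) (gaussianReal 0 v) := by
    refine (integrable_const (1 : ℝ)).mono' (by fun_prop) (Eventually.of_forall fun z => ?_)
    have := Complex.norm_exp_ofReal_mul_I (t * z)
    push_cast at this
    exact this.le
  have h2 := congrArg Complex.re h
  rw [← RCLike.re_eq_complex_re, ← integral_re hi] at h2
  have h3 : ∀ z : ℝ, RCLike.re (Complex.exp (t * z * Complex.I)) = Real.cos (z * t) := by
    intro z
    have := Complex.exp_ofReal_mul_I_re (t * z)
    push_cast at this
    rw [mul_comm z t, ← this]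
    rfl
  simp only [h3] at h2
  rw [h2]
  have : ((t : ℂ) * (0 : ℝ) * Complex.I - v * t ^ 2 / 2) = ((-(v * t ^ 2 / 2) : ℝ) : ℂ) := by
    push_cast
    ring
  rw [this]
  exact Complex.exp_ofReal_re _

theorem integral_abs_gaussianReal {v : NNReal} (hv : v ≠ 0) :
    ∫ z, |z| ∂gaussianReal 0 v = Real.sqrt (2 * v / Real.pi) := by
  have hv0 : (0 : ℝ) < v := by exact_mod_cast pos_iff_ne_zero.2 hv
  have h1 := integral_rpow_mul_exp_neg_mul_rpow (p := 2) (q := 1) (b := (2 * v : ℝ)⁻¹)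
    two_pos (by norm_num) (by positivity)
  rw [integral_gaussianReal_eq_integral_smul hv]
  have h2 : ∀ z : ℝ, gaussianPDFReal 0 v z • |z| =
      (fun y : ℝ => (Real.sqrt (2 * Real.pi * v))⁻¹ *
        (y ^ (1 : ℝ) * Real.exp (-(2 * v : ℝ)⁻¹ * y ^ (2 : ℝ)))) |z| := by
    intro z
    simp only [gaussianPDFReal, smul_eq_mul, sub_zero, Real.rpow_one, Real.rpow_two, sq_abs]
    rw [mul_assoc, mul_comm |z|]
    congr 3
    field_simp
  rw [integral_congr_ae (Eventually.of_forall h2), integral_comp_abs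
    (f := fun y : ℝ => (Real.sqrt (2 * Real.pi * v))⁻¹ *
        (y ^ (1 : ℝ) * Real.exp (-(2 * v : ℝ)⁻¹ * y ^ (2 : ℝ)))), integral_const_mul, h1]
  have h3 : ((2 * v : ℝ)⁻¹) ^ (-(1 + 1) / 2 : ℝ) = 2 * v := by
    rw [show (-(1 + 1) / 2 : ℝ) = -1 by norm_num, Real.rpow_neg_one, inv_inv]
  have h4 : Real.sqrt (2 * v / Real.pi) * Real.sqrt (2 * Real.pi * v) = 2 * v := by
    rw [← Real.sqrt_mul (by positivity), show 2 * (v : ℝ) / Real.pi * (2 * Real.pi * v) =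
      (2 * v) ^ 2 by field_simp]
    exact Real.sqrt_sq (by positivity)
  have h5 : 0 < Real.sqrt (2 * Real.pi * v) := Real.sqrt_pos.2 (by positivity)
  rw [h3, show ((1 + 1) / 2 : ℝ) = 1 by norm_num, Real.Gamma_one,
    eq_div_of_mul_eq h5.ne' h4]
  field_simp

/-- Average the cosine representation of |z| over a centred Gaussian z of variance v and exchange
the integrals. -/
theorem integral_one_sub_exp_div_sq {v : NNReal} (hv : v ≠ 0) :
    ∫ t : ℝ, (1 - Real.exp (-(v * t ^ 2 / 2))) / t ^ 2 =
      cosKernelMass * Real.sqrt (2 * v / Real.pi) := by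
  have hi : Integrable (Function.uncurry fun z t : ℝ => (1 - Real.cos (z * t)) / t ^ 2)
      ((gaussianReal 0 v).prod volume) := by
    refine (integrable_prod_iff (Measurable.aestronglyMeasurable
      (by unfold Function.uncurry; fun_prop))).2 ⟨?_, ?_⟩
    · exact Eventually.of_forall fun z => integrable_one_sub_cos_div_sq z
    · have : (fun z : ℝ => ∫ t : ℝ, ‖Function.uncurry
          (fun z t : ℝ => (1 - Real.cos (z * t)) / t ^ 2) (z, t)‖) =
          fun z => cosKernelMass * |z| := by
        ext z
        rw [← integral_one_sub_cos_div_sq]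
        refine integral_congr_ae (Eventually.of_forall fun t => ?_)
        exact Real.norm_of_nonneg (one_sub_cos_div_sq_nonneg z t)
      rw [this]
      exact (((memLp_id_gaussianReal 1).integrable le_rfl).abs).const_mul _
  have h := integral_integral_swap hi
  simp only [integral_one_sub_cos_div_sq, integral_const_mul, integral_abs_gaussianReal hv] at h
  rw [h]
  refine integral_congr_ae (Eventually.of_forall fun t => ?_)
  simp only
  rw [integral_div, integral_sub (integrable_const _), integral_cos_gaussianReal]
  · simp
  · refine (integrable_const (1 : ℝ)).mono' (by fun_prop) (Eventually.of_forall fun z => ?_)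
    exact Real.abs_cos_le_one _

/-! ### Limit of the mean absolute difference of two binomials. -/

theorem integrable_multinomialMean {α : Type*} [MeasurableSpace α] {ν : Measure α} (m : ℕ)
    (x : Fin d → ℝ) {f : (Fin d → ℕ) → α → ℝ} (hf : ∀ k, Integrable (f k) ν) :
    Integrable (fun t => multinomialMean m x fun k => f k t) ν :=
  integrable_finsetSum _ fun k _ => (hf k).mul_const _

theorem integral_multinomialMean {α : Type*} [MeasurableSpace α] {ν : Measure α} (m : ℕ)
    (x : Fin d → ℝ) {f : (Fin d → ℕ) → α → ℝ} (hf : ∀ k, Integrable (f k) ν) :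
    ∫ t, multinomialMean m x (fun k => f k t) ∂ν =
      multinomialMean m x fun k => ∫ t, f k t ∂ν := by
  unfold multinomialMean
  rw [integral_finsetSum _ fun k _ => (hf k).mul_const _]
  simp only [integral_mul_const]

theorem cosKernelMass_mul_multinomialMean_abs_sub (m : ℕ) (x : Fin d → ℝ) (i : Fin d) (r : ℝ) :
    cosKernelMass * multinomialMean m x (fun k => multinomialMean m x fun l =>
        |r * ((k i : ℝ) - l i)|) =
      ∫ t : ℝ, (1 - (1 - 2 * (x i * (1 - x i)) * (1 - Real.cos (t * r))) ^ m) / t ^ 2 := by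
  simp only [← multinomialMean_const_mul, ← integral_one_sub_cos_div_sq]
  rw [← funext fun k : Fin d → ℕ => integral_multinomialMean m x fun l : Fin d → ℕ =>
      integrable_one_sub_cos_div_sq (r * ((k i : ℝ) - l i)),
    ← integral_multinomialMean m x fun k => integrable_multinomialMean m x fun l =>
      integrable_one_sub_cos_div_sq (r * ((k i : ℝ) - l i))]
  refine integral_congr_ae (Eventually.of_forall fun t => ?_)
  simp only [div_eq_inv_mul, multinomialMean_const_mul, multinomialMean_sub,
    multinomialMean_const]
  rw [← multinomialMean_cos_sub]
  simp only [mul_assoc, mul_comm, mul_left_comm]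

theorem tendsto_mul_one_sub_cos_div_sqrt (t : ℝ) :
    Tendsto (fun m : ℕ => (m : ℝ) * (1 - Real.cos (t * (Real.sqrt m)⁻¹))) atTop
      (𝓝 (t ^ 2 / 2)) := by
  have hs : Tendsto (fun m : ℕ => (Real.sqrt m)⁻¹) atTop (𝓝 0) :=
    tendsto_inv_atTop_zero.comp (Real.tendsto_sqrt_atTop.comp tendsto_natCast_atTop_atTop)
  have hts : Tendsto (fun m : ℕ => |t * (Real.sqrt m)⁻¹|) atTop (𝓝 0) := by
    simpa using (hs.const_mul t).abs
  rw [tendsto_iff_dist_tendsto_zero]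
  have hb : Tendsto (fun m : ℕ => t ^ 4 * ((Real.sqrt m)⁻¹) ^ 2) atTop (𝓝 0) := by
    simpa using (hs.pow 2).const_mul (t ^ 4)
  refine squeeze_zero' (Eventually.of_forall fun _ => dist_nonneg) ?_ hb
  filter_upwards [hts.eventually_le_const one_pos, eventually_gt_atTop 0] with m hm hm0
  have h := Real.cos_bound hm
  have hm' : (0 : ℝ) < m := by exact_mod_cast hm0
  have hq : ((Real.sqrt m)⁻¹) ^ 2 = (m : ℝ)⁻¹ := by rw [inv_pow, Real.sq_sqrt hm'.le]
  have h4 : |t * (Real.sqrt m)⁻¹| ^ 4 = t ^ 4 * (m : ℝ)⁻¹ ^ 2 := by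
    rw [← abs_pow, abs_of_nonneg (by positivity), mul_pow, ← hq]
    ring
  rw [h4, mul_pow, hq] at h
  rw [Real.dist_eq, hq]
  have e : (m : ℝ) * (1 - Real.cos (t * (Real.sqrt m)⁻¹)) - t ^ 2 / 2 =
      -(m * (Real.cos (t * (Real.sqrt m)⁻¹) - (1 - t ^ 2 * (m : ℝ)⁻¹ / 2))) := by
    field_simp
    ring
  rw [e, abs_neg, abs_mul, abs_of_pos hm']
  calc (m : ℝ) * _ ≤ m * (t ^ 4 * (m : ℝ)⁻¹ ^ 2 * (5 / 96)) :=
        mul_le_mul_of_nonneg_left h hm'.le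
    _ = t ^ 4 * (m : ℝ)⁻¹ * (5 / 96) := by field_simp
    _ ≤ t ^ 4 * (m : ℝ)⁻¹ := mul_le_of_le_one_right (by positivity) (by norm_num)

theorem tendsto_integral_one_sub_pow {q : ℝ} (hq0 : 0 ≤ q) (hq1 : 4 * q ≤ 1) :
    Tendsto (fun m : ℕ => ∫ t : ℝ,
      (1 - (1 - 2 * q * (1 - Real.cos (t * (Real.sqrt m)⁻¹))) ^ m) / t ^ 2) atTop
      (𝓝 (∫ t : ℝ, (1 - Real.exp (-(q * t ^ 2))) / t ^ 2)) := by
  refine tendsto_integral_of_dominated_convergence (fun t => (2 + q) * (1 + t ^ 2)⁻¹)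
    (fun m => Measurable.aestronglyMeasurable (by fun_prop)) (integrable_inv_one_add_sq.const_mul _)
    (fun m => Eventually.of_forall fun t => ?_) (Eventually.of_forall fun t => ?_)
  · have hc1 := Real.cos_le_one (t * (Real.sqrt m)⁻¹)
    have hc2 := Real.neg_one_le_cos (t * (Real.sqrt m)⁻¹)
    -- Since 1 − cos is at most 2, the condition 4q ≤ 1 keeps the base of the power nonnegative.
    have hb0 : 0 ≤ 1 - 2 * q * (1 - Real.cos (t * (Real.sqrt m)⁻¹)) := by nlinarith
    have hb1 : 1 - 2 * q * (1 - Real.cos (t * (Real.sqrt m)⁻¹)) ≤ 1 := by nlinarith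
    have hp0 := pow_nonneg hb0 m
    have hp1 := pow_le_one₀ (n := m) hb0 hb1
    rw [Real.norm_of_nonneg (div_nonneg (sub_nonneg.2 hp1) (sq_nonneg t))]
    refine one_sub_div_sq_le hq0 (by linarith) ?_
    -- Bernoulli's inequality bounds 1 minus the power by 2qm(1 − cos(t/√m)) ≤ q t², uniformly in m.
    have hB := one_add_mul_le_pow (a := -(2 * q * (1 - Real.cos (t * (Real.sqrt m)⁻¹))))
      (by linarith) m
    rw [← sub_eq_add_neg] at hB
    have hcos := Real.one_sub_sq_div_two_le_cos (x := t * (Real.sqrt m)⁻¹)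
    rcases Nat.eq_zero_or_pos m with rfl | hm
    · simp
      positivity
    · have hm' : (0 : ℝ) < m := by exact_mod_cast hm
      have hmm : m * (t * (Real.sqrt m)⁻¹) ^ 2 = t ^ 2 := by
        rw [mul_pow, inv_pow, Real.sq_sqrt hm'.le]
        field_simp
      have : (m : ℝ) * (1 - Real.cos (t * (Real.sqrt m)⁻¹)) ≤ t ^ 2 / 2 := by nlinarith
      nlinarith
  · refine Tendsto.div_const (tendsto_const_nhds.sub ?_) _
    simp only [sub_eq_add_neg (1 : ℝ) (2 * q * _)]
    refine Real.tendsto_one_add_pow_exp_of_tendsto ?_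
    have h := (tendsto_mul_one_sub_cos_div_sqrt t).const_mul (-(2 * q))
    refine (h.congr fun m => by ring).trans_eq ?_
    congr 1
    ring

/-- The mean absolute difference of two independent binomial variables. -/
theorem tendsto_multinomialMean_abs_sub {x : Fin d → ℝ} (i : Fin d) (h0 : 0 < x i)
    (h1 : x i < 1) :
    Tendsto (fun m : ℕ => multinomialMean m x fun k => multinomialMean m x fun l =>
        |(Real.sqrt m)⁻¹ * ((k i : ℝ) - l i)|) atTop
      (𝓝 (2 * Real.sqrt (x i * (1 - x i) / Real.pi))) := by
  set q := x i * (1 - x i) with hq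
  have hq0 : 0 < q := mul_pos h0 (sub_pos.2 h1)
  have hq1 : 4 * q ≤ 1 := by nlinarith [sq_nonneg (2 * x i - 1)]
  have hc := cosKernelMass_pos
  have h := tendsto_integral_one_sub_pow hq0.le hq1
  -- The variance of (k_i − l_i)/√m is 2q.
  have hv := integral_one_sub_exp_div_sq (v := (2 * q).toNNReal)
    (Real.toNNReal_pos.2 (by positivity)).ne'
  rw [Real.coe_toNNReal _ (by positivity)] at hv
  have e1 : ∀ t : ℝ, 2 * q * t ^ 2 / 2 = q * t ^ 2 := fun t => by ring
  have e2 : Real.sqrt (2 * (2 * q) / Real.pi) = 2 * Real.sqrt (q / Real.pi) := by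
    rw [show 2 * (2 * q) / Real.pi = 2 ^ 2 * (q / Real.pi) by ring,
      Real.sqrt_mul (by norm_num), Real.sqrt_sq (by norm_num)]
  simp only [e1, e2] at hv
  rw [hv] at h
  refine ((h.const_mul cosKernelMass⁻¹).congr fun m => ?_).trans_eq ?_
  · rw [← cosKernelMass_mul_multinomialMean_abs_sub, ← mul_assoc, inv_mul_cancel₀ hc.ne', one_mul]
  · rw [← mul_assoc, inv_mul_cancel₀ hc.ne', one_mul]

/-! ### The simplex and Taylor expansion with uniform remainders. -/

theorem convex_simplex (d : ℕ) : Convex ℝ (simplex d) := by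
  intro x hx y hy a b ha hb hab
  refine ⟨fun i => ?_, ?_⟩
  · have := hx.1 i
    have := hy.1 i
    simp only [Pi.add_apply, Pi.smul_apply, smul_eq_mul]
    positivity
  · simp only [Pi.add_apply, Pi.smul_apply, smul_eq_mul, Finset.sum_add_distrib,
      ← Finset.mul_sum]
    nlinarith [hx.2, hy.2]

theorem isCompact_simplex (d : ℕ) : IsCompact (simplex d) := by
  refine (isCompact_Icc (a := (0 : Fin d → ℝ)) (b := 1)).of_isClosed_subset ?_
    fun x hx => ⟨hx.1, fun i => apply_le_one hx i⟩
  have h : simplex d = (⋂ i, {x : Fin d → ℝ | 0 ≤ x i}) ∩ {x | ∑ i, x i ≤ 1} := by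
    ext x
    simp [simplex]
  rw [h]
  exact (isClosed_iInter fun i => isClosed_le continuous_const (continuous_apply i)).inter
    (isClosed_le (by fun_prop) continuous_const)

theorem simplexInterior_subset_simplex (d : ℕ) : simplexInterior d ⊆ simplex d :=
  fun _ hx => ⟨fun i => (hx.1 i).le, hx.2.le⟩

theorem uniqueDiffOn_simplex (d : ℕ) : UniqueDiffOn ℝ (simplex d) := by
  -- A convex set with nonempty interior has unique derivatives; the witness has coordinate sum d/(d
  -- + 1) < 1.
  refine uniqueDiffOn_convex (convex_simplex d) ⟨fun _ => ((d : ℝ) + 1)⁻¹, ?_⟩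
  have ho : IsOpen (simplexInterior d) := by
    have h : simplexInterior d = (⋂ i, {x : Fin d → ℝ | 0 < x i}) ∩ {x | ∑ i, x i < 1} := by
      ext x
      simp [simplexInterior]
    rw [h]
    exact (isOpen_iInter_of_finite fun i =>
      isOpen_lt continuous_const (continuous_apply i)).inter
        (isOpen_lt (by fun_prop) continuous_const)
  refine interior_maximal (simplexInterior_subset_simplex d) ho ⟨fun i => by positivity, ?_⟩
  rw [Finset.sum_const, Finset.card_univ, Fintype.card_fin, nsmul_eq_mul, ← div_eq_mul_inv,
    div_lt_one (by positivity)]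
  linarith

theorem contDiffOn_partialDeriv {F : (Fin d → ℝ) → ℝ} {n n' : WithTop ℕ∞}
    (hF : ContDiffOn ℝ n F (simplex d)) (hn : n' + 1 ≤ n) (i : Fin d) :
    ContDiffOn ℝ n' (partialDeriv i F) (simplex d) :=
  (hF.fderivWithin (uniqueDiffOn_simplex d) hn).clm_apply contDiffOn_const

theorem hasDerivWithinAt_segment {F : (Fin d → ℝ) → ℝ} (hF : ContDiffOn ℝ 1 F (simplex d))
    {x v : Fin d → ℝ} (hx : x ∈ simplex d) (hv : x + v ∈ simplex d) {t : ℝ}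
    (ht : t ∈ Set.Icc (0 : ℝ) 1) :
    HasDerivWithinAt (fun s : ℝ => F (x + s • v))
      (∑ i, v i * partialDeriv i F (x + t • v)) (Set.Icc 0 1) t := by
  have hmaps : Set.MapsTo (fun s : ℝ => x + s • v) (Set.Icc 0 1) (simplex d) :=
    fun s hs => (convex_simplex d).add_smul_mem hx hv hs
  have h1 := ((hF.differentiableOn one_ne_zero) _ (hmaps ht)).hasFDerivWithinAt
  have h2 : HasDerivWithinAt (fun s : ℝ => x + s • v) v (Set.Icc 0 1) t := by
    simpa using (((hasDerivAt_id t).smul_const v).const_add x).hasDerivWithinAt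
  have h3 := h1.comp_hasDerivWithinAt t h2 hmaps
  refine h3.congr_deriv ?_
  refine (LinearMap.pi_apply_eq_sum_univ
    (fderivWithin ℝ F (simplex d) (x + t • v) : (Fin d → ℝ) →ₗ[ℝ] ℝ) v).trans
      (Finset.sum_congr rfl fun i _ => ?_)
  rw [partialDeriv, smul_eq_mul, ContinuousLinearMap.coe_coe]
  congr 2
  ext j
  simp [Pi.single_apply, eq_comm]

/-- Uniform continuity handles nearby points; at distance at least δ the bound 2|M| is absorbed by
2|M|‖y − x‖²/δ². A polynomial bound of this kind can be averaged using moments alone, without tail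
estimates. -/
theorem exists_modulus_sq {E : Type*} [NormedAddCommGroup E] {S : Set E} (hS : IsCompact S) {H : E → ℝ}
    (hH : ContinuousOn H S) {ε : ℝ} (hε : 0 < ε) :
    ∃ C, 0 ≤ C ∧ ∀ x ∈ S, ∀ y ∈ S, |H y - H x| ≤ ε + C * ‖y - x‖ ^ 2 := by
  obtain ⟨M, hM⟩ := hS.exists_bound_of_continuousOn hH
  obtain ⟨δ, hδ, hu⟩ := Metric.uniformContinuousOn_iff.1
    (hS.uniformContinuousOn_of_continuous hH) ε hε
  refine ⟨2 * |M| / δ ^ 2, by positivity, fun x hx y hy => ?_⟩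
  rcases lt_or_ge ‖y - x‖ δ with h | h
  · have := hu y hy x hx (by rwa [dist_eq_norm])
    rw [Real.dist_eq] at this
    have : 0 ≤ 2 * |M| / δ ^ 2 * ‖y - x‖ ^ 2 := by positivity
    linarith
  · have h1 : |H y - H x| ≤ 2 * |M| := by
      have h2 := hM x hx
      have h3 := hM y hy
      have h4 := le_abs_self M
      rw [Real.norm_eq_abs] at h2 h3
      have := abs_sub (H y) (H x)
      linarith
    have h2 : 2 * |M| ≤ 2 * |M| / δ ^ 2 * ‖y - x‖ ^ 2 := by
      rw [div_mul_eq_mul_div, le_div_iff₀ (by positivity)]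
      gcongr
    linarith

theorem abs_mul_abs_le_sum_sq (v : Fin d → ℝ) (i j : Fin d) :
    |v i| * |v j| ≤ ∑ l, v l ^ 2 := by
  have hi := Finset.single_le_sum (f := fun l => v l ^ 2) (fun l _ => sq_nonneg _)
    (Finset.mem_univ i)
  have hj := Finset.single_le_sum (f := fun l => v l ^ 2) (fun l _ => sq_nonneg _)
    (Finset.mem_univ j)
  rw [← sq_abs] at hi hj
  nlinarith [sq_nonneg (|v i| - |v j|)]

theorem norm_sq_le_sum_sq (v : Fin d → ℝ) : ‖v‖ ^ 2 ≤ ∑ l, v l ^ 2 := by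
  have hs : 0 ≤ ∑ l, v l ^ 2 := Finset.sum_nonneg fun l _ => sq_nonneg _
  refine (Real.le_sqrt (norm_nonneg _) hs).1 ((pi_norm_le_iff_of_nonneg (Real.sqrt_nonneg _)).2
    fun i => Real.abs_le_sqrt ?_)
  exact Finset.single_le_sum (f := fun l => v l ^ 2) (fun l _ => sq_nonneg _) (Finset.mem_univ i)

theorem sum_sq_sq_le (v : Fin d → ℝ) : (∑ l, v l ^ 2) ^ 2 ≤ d * ∑ l, v l ^ 4 := by
  have h := sq_sum_le_card_mul_sum_sq (s := Finset.univ) (f := fun l => v l ^ 2)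
  simpa [← pow_mul] using h

/-- Subtract the quadratic Taylor polynomial along the segment and apply the mean value inequality
twice on [0, 1]. The factor d² counts the pairs (i, j); it is not sharp. -/
theorem abs_taylor_remainder_le {F : (Fin d → ℝ) → ℝ} (hF : ContDiffOn ℝ 2 F (simplex d))
    {x v : Fin d → ℝ} (hx : x ∈ simplex d) (hv : x + v ∈ simplex d) {M : ℝ}
    (hM : ∀ t ∈ Set.Icc (0 : ℝ) 1, ∀ i j, |partialDeriv i (partialDeriv j F) (x + t • v) -
      partialDeriv i (partialDeriv j F) x| ≤ M) :
    |F (x + v) - F x - ∑ j, v j * partialDeriv j F x -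
      (1 / 2 : ℝ) * ∑ i, ∑ j, v i * v j * partialDeriv i (partialDeriv j F) x| ≤
      d ^ 2 * M * ∑ l, v l ^ 2 := by
  set g := ∑ j, v j * partialDeriv j F x with hg
  set h := ∑ i, ∑ j, v i * v j * partialDeriv i (partialDeriv j F) x with hh
  have hF1 : ContDiffOn ℝ 1 F (simplex d) := hF.of_le (by norm_num)
  have hG : ∀ j, ContDiffOn ℝ 1 (partialDeriv j F) (simplex d) := fun j =>
    contDiffOn_partialDeriv hF (by norm_num) j
  have h0 : (0 : ℝ) ∈ Set.Icc (0 : ℝ) 1 := ⟨le_rfl, zero_le_one⟩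
  have h1 : (1 : ℝ) ∈ Set.Icc (0 : ℝ) 1 := ⟨zero_le_one, le_rfl⟩
  have hM0 : 0 ≤ d ^ 2 * M * ∑ l, v l ^ 2 := by
    have hs : 0 ≤ ∑ l, v l ^ 2 := Finset.sum_nonneg fun l _ => sq_nonneg _
    -- For d = 0 there are no indices from which M ≥ 0 could be read off.
    rcases Nat.eq_zero_or_pos d with hd | hd
    · simp [hd]
    · have : 0 ≤ M := (abs_nonneg _).trans (hM 0 h0 ⟨0, hd⟩ ⟨0, hd⟩)
      positivity
  have d1 : ∀ t ∈ Set.Icc (0 : ℝ) 1,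
      HasDerivWithinAt (fun s : ℝ => F (x + s • v) - s * g - s ^ 2 / 2 * h)
        ((∑ j, v j * partialDeriv j F (x + t • v)) - g - t * h) (Set.Icc 0 1) t := by
    intro t ht
    have e1 : HasDerivWithinAt (fun s : ℝ => s * g) g (Set.Icc 0 1) t := by
      simpa using ((hasDerivAt_id t).mul_const g).hasDerivWithinAt
    have e2 : HasDerivWithinAt (fun s : ℝ => s ^ 2 / 2 * h) (t * h) (Set.Icc 0 1) t := by
      exact ((((hasDerivAt_pow 2 t).div_const 2).mul_const h).congr_deriv
        (by norm_num)).hasDerivWithinAt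
    exact ((hasDerivWithinAt_segment hF1 hx hv ht).sub e1).sub e2
  have d2 : ∀ t ∈ Set.Icc (0 : ℝ) 1,
      HasDerivWithinAt (fun s : ℝ => (∑ j, v j * partialDeriv j F (x + s • v)) - g - s * h)
        ((∑ j, v j * ∑ i, v i * partialDeriv i (partialDeriv j F) (x + t • v)) - h)
        (Set.Icc 0 1) t := by
    intro t ht
    have e1 : HasDerivWithinAt (fun s : ℝ => s * h) h (Set.Icc 0 1) t := by
      simpa using ((hasDerivAt_id t).mul_const h).hasDerivWithinAt
    have e2 : HasDerivWithinAt (fun s : ℝ => ∑ j, v j * partialDeriv j F (x + s • v))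
        (∑ j, v j * ∑ i, v i * partialDeriv i (partialDeriv j F) (x + t • v))
        (Set.Icc 0 1) t :=
      HasDerivWithinAt.fun_sum fun j _ =>
        (hasDerivWithinAt_segment (hG j) hx hv ht).const_mul (v j)
    exact (e2.sub_const g).sub e1
  have b2 : ∀ t ∈ Set.Icc (0 : ℝ) 1,
      ‖(∑ j, v j * ∑ i, v i * partialDeriv i (partialDeriv j F) (x + t • v)) - h‖ ≤
        d ^ 2 * M * ∑ l, v l ^ 2 := by
    intro t ht
    -- Only the order of summation is exchanged; symmetry of the second derivatives plays no role.
    have e : (∑ j, v j * ∑ i, v i * partialDeriv i (partialDeriv j F) (x + t • v)) - h =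
        ∑ i, ∑ j, v i * v j * (partialDeriv i (partialDeriv j F) (x + t • v) -
          partialDeriv i (partialDeriv j F) x) := by
      simp only [mul_sub, Finset.sum_sub_distrib, hh, Finset.mul_sum]
      congr 1
      rw [Finset.sum_comm]
      exact Finset.sum_congr rfl fun i _ => Finset.sum_congr rfl fun j _ => by ring
    rw [e, Real.norm_eq_abs]
    calc |∑ i, ∑ j, v i * v j * (partialDeriv i (partialDeriv j F) (x + t • v) -
          partialDeriv i (partialDeriv j F) x)|
        ≤ ∑ i : Fin d, ∑ j : Fin d, (∑ l, v l ^ 2) * M := by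
          refine (Finset.abs_sum_le_sum_abs _ _).trans (Finset.sum_le_sum fun i _ =>
            (Finset.abs_sum_le_sum_abs _ _).trans (Finset.sum_le_sum fun j _ => ?_))
          rw [abs_mul, abs_mul]
          exact mul_le_mul (abs_mul_abs_le_sum_sq v i j) (hM t ht i j) (abs_nonneg _)
            (Finset.sum_nonneg fun l _ => sq_nonneg _)
      _ = d ^ 2 * M * ∑ l, v l ^ 2 := by
          simp only [Finset.sum_const, Finset.card_univ, Fintype.card_fin, nsmul_eq_mul]
          ring
  have b1 : ∀ t ∈ Set.Icc (0 : ℝ) 1,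
      ‖(∑ j, v j * partialDeriv j F (x + t • v)) - g - t * h‖ ≤ d ^ 2 * M * ∑ l, v l ^ 2 := by
    intro t ht
    have := (convex_Icc (0 : ℝ) 1).norm_image_sub_le_of_norm_hasDerivWithin_le d2 b2 h0 ht
    simp only [zero_smul, add_zero, ← hg, sub_self, zero_mul, sub_zero] at this
    refine this.trans (mul_le_of_le_one_right hM0 ?_)
    rw [Real.norm_of_nonneg ht.1]
    exact ht.2
  have := (convex_Icc (0 : ℝ) 1).norm_image_sub_le_of_norm_hasDerivWithin_le d1 b1 h0 h1
  simp only [one_smul, zero_smul, add_zero] at this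
  norm_num at this
  refine le_trans (le_of_eq ?_) this
  congr 1
  ring

/-- Second-order Taylor expansion on the simplex with a uniform remainder. -/
theorem exists_taylor_two {F : (Fin d → ℝ) → ℝ} (hF : ContDiffOn ℝ 2 F (simplex d))
    {ε : ℝ} (hε : 0 < ε) :
    ∃ C, 0 ≤ C ∧ ∀ x ∈ simplex d, ∀ y ∈ simplex d,
      |F y - F x - ∑ j, (y j - x j) * partialDeriv j F x -
        (1 / 2 : ℝ) * ∑ i, ∑ j, (y i - x i) * (y j - x j) *
          partialDeriv i (partialDeriv j F) x| ≤
        ε * ∑ l, (y l - x l) ^ 2 + C * ∑ l, (y l - x l) ^ 4 := by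
  have hη : 0 < ε / ((d : ℝ) ^ 2 + 1) := by positivity
  have hH : ∀ i j, ContinuousOn (partialDeriv i (partialDeriv j F)) (simplex d) := fun i j =>
    (contDiffOn_partialDeriv (n := 1) (n' := 0)
      (contDiffOn_partialDeriv hF (by norm_num) j) (by norm_num) i).continuousOn
  choose K hK0 hK using fun i j => exists_modulus_sq (isCompact_simplex d) (hH i j) hη
  set C := ∑ i, ∑ j, K i j with hC
  have hKC : ∀ i j, K i j ≤ C := fun i j =>
    (Finset.single_le_sum (fun j _ => hK0 i j) (Finset.mem_univ j)).trans
      (Finset.single_le_sum (f := fun i => ∑ j, K i j)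
        (fun i _ => Finset.sum_nonneg fun j _ => hK0 i j) (Finset.mem_univ i))
  have hC0 : 0 ≤ C := Finset.sum_nonneg fun i _ => Finset.sum_nonneg fun j _ => hK0 i j
  -- The factor d² comes from the remainder bound, the last d from Cauchy–Schwarz in `sum_sq_sq_le`.
  refine ⟨d ^ 2 * C * d, by positivity, fun x hx y hy => ?_⟩
  have hxy : x + (y - x) ∈ simplex d := by simpa using hy
  have h := abs_taylor_remainder_le hF hx hxy
    (M := ε / ((d : ℝ) ^ 2 + 1) + C * ∑ l, (y - x) l ^ 2) (fun t ht i j => by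
      refine (hK i j x hx _ ((convex_simplex d).add_smul_mem hx hxy ht)).trans ?_
      rw [add_sub_cancel_left, norm_smul, Real.norm_of_nonneg ht.1]
      have h1 : (t * ‖y - x‖) ^ 2 ≤ ∑ l, (y - x) l ^ 2 := by
        refine le_trans ?_ (norm_sq_le_sum_sq (y - x))
        exact pow_le_pow_left₀ (mul_nonneg ht.1 (norm_nonneg _))
          (mul_le_of_le_one_left (norm_nonneg _) ht.2) 2
      have h2 := mul_le_mul (hKC i j) h1 (by positivity) hC0
      linarith)
  simp only [add_sub_cancel, Pi.sub_apply] at h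
  refine h.trans ?_
  have hs : 0 ≤ ∑ l, (y l - x l) ^ 2 := Finset.sum_nonneg fun l _ => sq_nonneg _
  have h4 := sum_sq_sq_le (fun l => y l - x l)
  have h5 : (d : ℝ) ^ 2 * (ε / ((d : ℝ) ^ 2 + 1)) ≤ ε := by
    rw [mul_div_assoc', div_le_iff₀ (by positivity)]
    nlinarith
  calc (d : ℝ) ^ 2 * (ε / ((d : ℝ) ^ 2 + 1) + C * ∑ l, (y l - x l) ^ 2) * ∑ l, (y l - x l) ^ 2
      = d ^ 2 * (ε / ((d : ℝ) ^ 2 + 1)) * ∑ l, (y l - x l) ^ 2 +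
        d ^ 2 * C * (∑ l, (y l - x l) ^ 2) ^ 2 := by ring
    _ ≤ ε * ∑ l, (y l - x l) ^ 2 + d ^ 2 * C * (d * ∑ l, (y l - x l) ^ 4) := by gcongr
    _ = _ := by ring

/-- First-order Taylor expansion at a point of the simplex. -/
theorem exists_taylor_one {F : (Fin d → ℝ) → ℝ} (hF : ContDiffOn ℝ 2 F (simplex d))
    {x : Fin d → ℝ} (hx : x ∈ simplex d) :
    ∃ C, 0 ≤ C ∧ ∀ y ∈ simplex d,
      |F y - F x - ∑ j, (y j - x j) * partialDeriv j F x| ≤ C * ∑ l, (y l - x l) ^ 2 := by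
  obtain ⟨C, hC0, hC⟩ := exists_taylor_two hF one_pos
  refine ⟨1 + C + (1 / 2) * ∑ i, ∑ j, |partialDeriv i (partialDeriv j F) x|, by positivity,
    fun y hy => ?_⟩
  have h1 := hC x hx y hy
  have h2 : ∑ l, (y l - x l) ^ 4 ≤ ∑ l, (y l - x l) ^ 2 := by
    refine Finset.sum_le_sum fun l _ => ?_
    have a1 := apply_le_one hx l
    have a2 := apply_le_one hy l
    have a3 := hx.1 l
    have a4 := hy.1 l
    have : (y l - x l) ^ 2 ≤ 1 := by nlinarith
    nlinarith [sq_nonneg (y l - x l)]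
  have h3 : |∑ i, ∑ j, (y i - x i) * (y j - x j) * partialDeriv i (partialDeriv j F) x| ≤
      (∑ i, ∑ j, |partialDeriv i (partialDeriv j F) x|) * ∑ l, (y l - x l) ^ 2 := by
    rw [Finset.sum_mul]
    refine (Finset.abs_sum_le_sum_abs _ _).trans (Finset.sum_le_sum fun i _ => ?_)
    rw [Finset.sum_mul]
    refine (Finset.abs_sum_le_sum_abs _ _).trans (Finset.sum_le_sum fun j _ => ?_)
    rw [abs_mul, abs_mul, mul_comm |partialDeriv _ _ _|]
    exact mul_le_mul_of_nonneg_right (abs_mul_abs_le_sum_sq (fun l => y l - x l) i j)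
      (abs_nonneg _)
  have h4 := mul_le_mul_of_nonneg_left h2 hC0
  rw [abs_le] at h1 h3 ⊢
  constructor <;> linarith [h1.1, h1.2, h3.1, h3.2]

/-! ### Exact mean and variance of the estimator. -/

/-- The contribution of one observation `y` to the Bernstein estimator. -/
def bernsteinKernel (m : ℕ) (x y : Fin d → ℝ) : ℝ :=
  multinomialMean m x fun k => (Set.Iic fun i => (k i : ℝ) / m).indicator (fun _ => (1 : ℝ)) y

theorem bernsteinEstimator_eq {Ω : Type*} (X : ℕ → Ω → Fin d → ℝ) (n m : ℕ) (x : Fin d → ℝ)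
    (ω : Ω) : bernsteinEstimator X n m x ω =
      (n : ℝ)⁻¹ * ∑ i ∈ Finset.range n, bernsteinKernel m x (X i ω) := by
  rw [bernsteinEstimator, bernsteinPolynomial_eq]
  simp only [empiricalCDF, multinomialMean_const_mul, multinomialMean_sum]
  rfl

theorem integrable_indicator_Iic (μ : Measure (Fin d → ℝ)) [IsProbabilityMeasure μ]
    (a : Fin d → ℝ) : Integrable ((Set.Iic a).indicator fun _ => (1 : ℝ)) μ :=
  (integrable_const 1).indicator measurableSet_Iic

theorem measurable_bernsteinKernel (m : ℕ) (x : Fin d → ℝ) :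
    Measurable (bernsteinKernel m x) :=
  Finset.measurable_sum _ fun _ _ =>
    (measurable_const.indicator measurableSet_Iic).mul_const _

theorem memLp_bernsteinKernel (μ : Measure (Fin d → ℝ)) [IsProbabilityMeasure μ] (m : ℕ)
    (x : Fin d → ℝ) : MemLp (bernsteinKernel m x) 2 μ :=
  memLp_finsetSum _ fun k _ => by
    simpa only [mul_comm] using
      (((memLp_const (1 : ℝ)).indicator measurableSet_Iic).const_mul (multinomialWeight m k x))

theorem integral_indicator_Iic (μ : Measure (Fin d → ℝ)) (a : Fin d → ℝ) :
    ∫ y, (Set.Iic a).indicator (fun _ => (1 : ℝ)) y ∂μ = jointCDF μ a := by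
  rw [integral_indicator measurableSet_Iic]
  simp [jointCDF]

theorem integral_bernsteinKernel (μ : Measure (Fin d → ℝ)) [IsProbabilityMeasure μ] (m : ℕ)
    (x : Fin d → ℝ) :
    ∫ y, bernsteinKernel m x y ∂μ = bernsteinPolynomial m (jointCDF μ) x := by
  simp only [bernsteinKernel]
  rw [integral_multinomialMean m x fun k => integrable_indicator_Iic μ fun i => (k i : ℝ) / m]
  simp only [integral_indicator_Iic]
  rfl

/-- The square is a double expectation over independent k and l, and the product of the indicators
of two lower orthants is the indicator of the orthant below the meet. -/
theorem integral_bernsteinKernel_sq (μ : Measure (Fin d → ℝ)) [IsProbabilityMeasure μ] (m : ℕ)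
    (x : Fin d → ℝ) :
    ∫ y, bernsteinKernel m x y ^ 2 ∂μ = multinomialMean m x fun k => multinomialMean m x fun l =>
      jointCDF μ ((fun i => (k i : ℝ) / m) ⊓ fun i => (l i : ℝ) / m) := by
  have h : ∀ y, bernsteinKernel m x y ^ 2 =
      multinomialMean m x fun k => multinomialMean m x fun l =>
        (Set.Iic ((fun i => (k i : ℝ) / m) ⊓ fun i => (l i : ℝ) / m)).indicator
          (fun _ => (1 : ℝ)) y := by
    intro y
    have e : ∀ k l : Fin d → ℕ,
        (Set.Iic ((fun i => (k i : ℝ) / m) ⊓ fun i => (l i : ℝ) / m)).indicator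
          (fun _ => (1 : ℝ)) y = (Set.Iic fun i => (k i : ℝ) / m).indicator (fun _ => (1 : ℝ)) y *
          (Set.Iic fun i => (l i : ℝ) / m).indicator (fun _ => (1 : ℝ)) y := by
      intro k l
      rw [← Set.Iic_inter_Iic, ← Set.inter_indicator_mul]
      simp
    simp only [e, multinomialMean_const_mul]
    simp only [mul_comm _ (multinomialMean m x _), multinomialMean_const_mul]
    rw [sq]
    rfl
  simp only [h]
  rw [integral_multinomialMean m x fun k => integrable_multinomialMean m x fun l =>
    integrable_indicator_Iic μ ((fun i => (k i : ℝ) / m) ⊓ fun i => (l i : ℝ) / m)]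
  simp only [← integral_indicator_Iic μ]
  congr 1
  ext k
  exact integral_multinomialMean m x fun l =>
    integrable_indicator_Iic μ ((fun i => (k i : ℝ) / m) ⊓ fun i => (l i : ℝ) / m)

section Estimator

variable {Ω : Type*} [MeasurableSpace Ω] {P : Measure Ω}
  {μ : Measure (Fin d → ℝ)} [IsProbabilityMeasure μ] {X : ℕ → Ω → Fin d → ℝ}

theorem memLp_bernsteinKernel_comp (hlaw : ∀ i, HasLaw (X i) μ P) (m : ℕ) (x : Fin d → ℝ)
    (i : ℕ) : MemLp (bernsteinKernel m x ∘ X i) 2 P := by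
  have h := memLp_bernsteinKernel μ m x
  rw [← (hlaw i).map_eq] at h
  exact h.comp_of_map (hlaw i).aemeasurable

theorem integral_bernsteinEstimator [IsProbabilityMeasure P] (hlaw : ∀ i, HasLaw (X i) μ P) {n : ℕ} (hn : n ≠ 0)
    (m : ℕ) (x : Fin d → ℝ) :
    ∫ ω, bernsteinEstimator X n m x ω ∂P = bernsteinPolynomial m (jointCDF μ) x := by
  simp only [bernsteinEstimator_eq]
  have hi : ∀ i, Integrable (fun ω => bernsteinKernel m x (X i ω)) P := fun i =>
    (memLp_bernsteinKernel_comp hlaw m x i).integrable one_le_two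
  rw [integral_const_mul, integral_finsetSum _ fun i _ => hi i]
  have h : ∀ i, ∫ ω, bernsteinKernel m x (X i ω) ∂P = bernsteinPolynomial m (jointCDF μ) x :=
    fun i => ((hlaw i).integral_comp
      (measurable_bernsteinKernel m x).aestronglyMeasurable).trans (integral_bernsteinKernel μ m x)
  simp only [h, Finset.sum_const, Finset.card_range, nsmul_eq_mul]
  rw [inv_mul_cancel_left₀ (Nat.cast_ne_zero.2 hn)]

theorem variance_bernsteinEstimator [IsProbabilityMeasure P] (hlaw : ∀ i, HasLaw (X i) μ P)
    (hindep : iIndepFun X P) {n : ℕ} (hn : n ≠ 0) (m : ℕ) (x : Fin d → ℝ) :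
    variance (bernsteinEstimator X n m x) P = (n : ℝ)⁻¹ *
      ((multinomialMean m x fun k => multinomialMean m x fun l =>
        jointCDF μ ((fun i => (k i : ℝ) / m) ⊓ fun i => (l i : ℝ) / m)) -
        bernsteinPolynomial m (jointCDF μ) x ^ 2) := by
  have h1 : bernsteinEstimator X n m x = fun ω =>
      (n : ℝ)⁻¹ * (∑ i ∈ Finset.range n, bernsteinKernel m x ∘ X i) ω := by
    ext ω
    rw [bernsteinEstimator_eq, Finset.sum_apply]
    rfl
  have h2 : ∀ i, variance (bernsteinKernel m x ∘ X i) P = variance (bernsteinKernel m x) μ := by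
    intro i
    rw [← variance_map (by rw [(hlaw i).map_eq]; exact (measurable_bernsteinKernel m x).aemeasurable)
      (hlaw i).aemeasurable, (hlaw i).map_eq]
  rw [h1, variance_const_mul, IndepFun.variance_sum
    (fun i _ => memLp_bernsteinKernel_comp hlaw m x i) (fun i _ j _ hij =>
      (hindep.indepFun hij).comp (measurable_bernsteinKernel m x) (measurable_bernsteinKernel m x))]
  simp only [h2, Finset.sum_const, Finset.card_range, nsmul_eq_mul]
  rw [variance_eq_sub (memLp_bernsteinKernel μ m x), integral_bernsteinKernel,
    ← integral_bernsteinKernel_sq]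
  have : (n : ℝ) ≠ 0 := Nat.cast_ne_zero.2 hn
  simp only [Pi.pow_apply]
  field_simp

end Estimator

/-! ### Asymptotics of the Bernstein polynomial and of the mean at the minimum. -/

theorem div_mem_simplex {m : ℕ} {k : Fin d → ℕ} (hk : k ∈ multiIndices d m) :
    (fun i => (k i : ℝ) / m) ∈ simplex d := by
  refine ⟨fun i => by positivity, ?_⟩
  rw [← Finset.sum_div]
  refine div_le_one_of_le₀ ?_ (Nat.cast_nonneg m)
  exact_mod_cast mem_multiIndices.1 hk

theorem inf_mem_simplex {x y : Fin d → ℝ} (hx : x ∈ simplex d) (hy : y ∈ simplex d) :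
    x ⊓ y ∈ simplex d :=
  ⟨fun i => le_inf (hx.1 i) (hy.1 i),
    (Finset.sum_le_sum fun _ _ => inf_le_left).trans hx.2⟩

theorem div_sub_eq {m : ℕ} (hm : m ≠ 0) (a b : ℝ) : a / m - b = (m : ℝ)⁻¹ * (a - m * b) := by
  have : (m : ℝ) ≠ 0 := Nat.cast_ne_zero.2 hm
  field_simp

theorem multinomialMean_div_sub {m : ℕ} (hm : m ≠ 0) (x : Fin d → ℝ) (i : Fin d) :
    multinomialMean m x (fun k => (k i : ℝ) / m - x i) = 0 := by
  simp only [div_sub_eq hm, multinomialMean_const_mul, multinomialMean_centered, mul_zero]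

theorem multinomialMean_div_sub_mul {m : ℕ} (hm : m ≠ 0) (x : Fin d → ℝ) (i j : Fin d) :
    multinomialMean m x (fun k => ((k i : ℝ) / m - x i) * ((k j : ℝ) / m - x j)) =
      (m : ℝ)⁻¹ * ((if i = j then x i else 0) - x i * x j) := by
  have h : (fun k : Fin d → ℕ => ((k i : ℝ) / m - x i) * ((k j : ℝ) / m - x j)) =
      fun k => ((m : ℝ)⁻¹) ^ 2 * (((k i : ℝ) - m * x i) * ((k j : ℝ) - m * x j)) := by
    ext k
    rw [div_sub_eq hm, div_sub_eq hm]
    ring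
  have : (m : ℝ) ≠ 0 := Nat.cast_ne_zero.2 hm
  rw [h, multinomialMean_const_mul, multinomialMean_covariance]
  field_simp

theorem multinomialMean_div_sub_sq_le {x : Fin d → ℝ} (hx : x ∈ simplex d) {m : ℕ}
    (hm : m ≠ 0) (i : Fin d) :
    multinomialMean m x (fun k => ((k i : ℝ) / m - x i) ^ 2) ≤ (m : ℝ)⁻¹ := by
  have hm0 : (m : ℝ) ≠ 0 := Nat.cast_ne_zero.2 hm
  simp only [div_sub_eq hm, mul_pow, multinomialMean_const_mul]
  refine (mul_le_mul_of_nonneg_left (multinomialMean_sq_le hx m i) (by positivity)).trans_eq ?_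
  field_simp

theorem multinomialMean_div_sub_pow_four_le {x : Fin d → ℝ} (hx : x ∈ simplex d) {m : ℕ}
    (hm : m ≠ 0) (i : Fin d) :
    multinomialMean m x (fun k => ((k i : ℝ) / m - x i) ^ 4) ≤ 6 * (m : ℝ)⁻¹ ^ 2 := by
  have hm0 : (m : ℝ) ≠ 0 := Nat.cast_ne_zero.2 hm
  simp only [div_sub_eq hm, mul_pow, multinomialMean_const_mul]
  refine (mul_le_mul_of_nonneg_left (multinomialMean_pow_four_le hx m i)
    (by positivity)).trans_eq ?_
  field_simp

theorem abs_bernsteinPolynomial_sub_le {F : (Fin d → ℝ) → ℝ} {x : Fin d → ℝ}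
    (hx : x ∈ simplex d) {ε C : ℝ} (hε : 0 ≤ ε) (hC0 : 0 ≤ C)
    (hC : ∀ y ∈ simplex d, |F y - F x - ∑ j, (y j - x j) * partialDeriv j F x -
        (1 / 2 : ℝ) * ∑ i, ∑ j, (y i - x i) * (y j - x j) *
          partialDeriv i (partialDeriv j F) x| ≤
        ε * ∑ l, (y l - x l) ^ 2 + C * ∑ l, (y l - x l) ^ 4) {m : ℕ} (hm : m ≠ 0) :
    |bernsteinPolynomial m F x - F x - (m : ℝ)⁻¹ * biasTerm F x| ≤
      ε * (d * (m : ℝ)⁻¹) + C * (d * (6 * (m : ℝ)⁻¹ ^ 2)) := by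
  have h := abs_multinomialMean_le hx fun k hk => hC _ (div_mem_simplex (m := m) hk)
  have e : multinomialMean m x (fun k => F (fun i => (k i : ℝ) / m) - F x -
        ∑ j, ((k j : ℝ) / m - x j) * partialDeriv j F x -
        (1 / 2 : ℝ) * ∑ i, ∑ j, ((k i : ℝ) / m - x i) * ((k j : ℝ) / m - x j) *
          partialDeriv i (partialDeriv j F) x) =
      bernsteinPolynomial m F x - F x - (m : ℝ)⁻¹ * biasTerm F x := by
    rw [multinomialMean_sub, multinomialMean_sub, multinomialMean_sub, multinomialMean_const,
      multinomialMean_const_mul]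
    simp only [multinomialMean_sum, mul_comm _ (partialDeriv _ _ x), multinomialMean_const_mul,
      ← bernsteinPolynomial_eq, multinomialMean_div_sub hm, multinomialMean_div_sub_mul hm,
      biasTerm, Finset.mul_sum]
    simp only [mul_zero, Finset.sum_const_zero, sub_zero]
    congr 1
    exact Finset.sum_congr rfl fun i _ => Finset.sum_congr rfl fun j _ => by ring
  rw [e] at h
  refine h.trans ?_
  rw [multinomialMean_add, multinomialMean_const_mul, multinomialMean_const_mul,
    multinomialMean_sum, multinomialMean_sum]
  have h2 := Finset.sum_le_sum fun (i : Fin d) (_ : i ∈ Finset.univ) =>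
    multinomialMean_div_sub_sq_le hx hm i
  have h4 := Finset.sum_le_sum fun (i : Fin d) (_ : i ∈ Finset.univ) =>
    multinomialMean_div_sub_pow_four_le hx hm i
  simp only [Finset.sum_const, Finset.card_univ, Fintype.card_fin, nsmul_eq_mul] at h2 h4
  exact add_le_add (mul_le_mul_of_nonneg_left h2 hε) (mul_le_mul_of_nonneg_left h4 hC0)

/-- Voronovskaya's theorem on the simplex, uniformly in the point. -/
theorem eventually_abs_bernsteinPolynomial_sub_le {F : (Fin d → ℝ) → ℝ}
    (hF : ContDiffOn ℝ 2 F (simplex d)) {ε : ℝ} (hε : 0 < ε) :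
    ∀ᶠ m : ℕ in atTop, ∀ x ∈ simplex d,
      |bernsteinPolynomial m F x - F x - (m : ℝ)⁻¹ * biasTerm F x| ≤ ε * (m : ℝ)⁻¹ := by
  -- Summing second moments over coordinates costs a factor d, so this share contributes at most
  -- ε/2; the fourth moments supply the other half for large m.
  have hη : 0 < ε / (2 * ((d : ℝ) + 1)) := by positivity
  obtain ⟨C, hC0, hC⟩ := exists_taylor_two hF hη
  have hlim : Tendsto (fun m : ℕ => C * (d * 6) * (m : ℝ)⁻¹) atTop (𝓝 0) := by
    simpa using (tendsto_inv_atTop_nhds_zero_nat (𝕜 := ℝ)).const_mul (C * (d * 6))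
  filter_upwards [hlim.eventually_le_const (half_pos hε), eventually_ne_atTop 0] with m h1 hm x hx
  refine (abs_bernsteinPolynomial_sub_le hx hη.le hC0 (hC x hx) hm).trans ?_
  have h2 : ε / (2 * ((d : ℝ) + 1)) * d ≤ ε / 2 := by
    rw [div_mul_eq_mul_div, div_le_div_iff₀ (by positivity) two_pos]
    nlinarith
  have hm0 : 0 ≤ (m : ℝ)⁻¹ := by positivity
  calc ε / (2 * ((d : ℝ) + 1)) * (d * (m : ℝ)⁻¹) + C * (d * (6 * (m : ℝ)⁻¹ ^ 2))
      = (ε / (2 * ((d : ℝ) + 1)) * d + C * (d * 6) * (m : ℝ)⁻¹) * (m : ℝ)⁻¹ := by ring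
    _ ≤ (ε / 2 + ε / 2) * (m : ℝ)⁻¹ := by gcongr
    _ = ε * (m : ℝ)⁻¹ := by ring

theorem tendsto_inv_sqrt_nat : Tendsto (fun m : ℕ => (Real.sqrt m)⁻¹) atTop (𝓝 0) :=
  tendsto_inv_atTop_zero.comp (Real.tendsto_sqrt_atTop.comp tendsto_natCast_atTop_atTop)

theorem sqrt_mul_inv_nat (m : ℕ) : Real.sqrt m * (m : ℝ)⁻¹ = (Real.sqrt m)⁻¹ := by
  rw [← div_eq_mul_inv, Real.sqrt_div_self']
  simp

/-- The bias is O(1/m), hence invisible at the scale m^(-1/2) of the variance correction. -/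
theorem tendsto_sqrt_mul_bernsteinPolynomial_sub {F : (Fin d → ℝ) → ℝ}
    (hF : ContDiffOn ℝ 2 F (simplex d)) {x : Fin d → ℝ} (hx : x ∈ simplex d) :
    Tendsto (fun m : ℕ => Real.sqrt m * (bernsteinPolynomial m F x - F x)) atTop (𝓝 0) := by
  have hb : Tendsto (fun m : ℕ => (1 + |biasTerm F x|) * (Real.sqrt m)⁻¹) atTop (𝓝 0) := by
    simpa using tendsto_inv_sqrt_nat.const_mul (1 + |biasTerm F x|)
  refine squeeze_zero_norm' ?_ hb
  filter_upwards [eventually_abs_bernsteinPolynomial_sub_le hF one_pos] with m h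
  have h1 := abs_sub_abs_le_abs_sub (bernsteinPolynomial m F x - F x)
    ((m : ℝ)⁻¹ * biasTerm F x)
  have h2 := h x hx
  have hm0 : 0 ≤ (m : ℝ)⁻¹ := by positivity
  rw [abs_mul, abs_of_nonneg hm0] at h1
  rw [Real.norm_eq_abs, abs_mul, abs_of_nonneg (Real.sqrt_nonneg _), ← sqrt_mul_inv_nat]
  have := mul_le_mul_of_nonneg_left (show |bernsteinPolynomial m F x - F x| ≤
    (1 + |biasTerm F x|) * (m : ℝ)⁻¹ by linarith) (Real.sqrt_nonneg m)
  linarith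

/-- From min(a, b) = (a + b)/2 − |a − b|/2, where the centred averages vanish. -/
theorem multinomialMean_inf_sub {m : ℕ} (hm : m ≠ 0) (x : Fin d → ℝ) (i : Fin d) :
    Real.sqrt m * multinomialMean m x (fun k => multinomialMean m x fun l =>
        (k i : ℝ) / m ⊓ (l i : ℝ) / m - x i) =
      -(1 / 2) * multinomialMean m x fun k => multinomialMean m x fun l =>
        |(Real.sqrt m)⁻¹ * ((k i : ℝ) - l i)| := by
  have hm0 : (0 : ℝ) < m := Nat.cast_pos.2 (Nat.pos_of_ne_zero hm)
  have hs : 0 < Real.sqrt m := Real.sqrt_pos.2 hm0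
  have e : ∀ k l : Fin d → ℕ, (k i : ℝ) / m ⊓ (l i : ℝ) / m - x i =
      1 / 2 * ((k i : ℝ) / m - x i) + 1 / 2 * ((l i : ℝ) / m - x i) -
        1 / 2 * (Real.sqrt m)⁻¹ * |(Real.sqrt m)⁻¹ * ((k i : ℝ) - l i)| := by
    intro k l
    have h1 : (Real.sqrt m)⁻¹ * |(Real.sqrt m)⁻¹ * ((k i : ℝ) - l i)| =
        |(k i : ℝ) / m - (l i : ℝ) / m| := by
      rw [← sub_div, abs_div, abs_of_pos hm0, abs_mul, abs_of_pos (inv_pos.2 hs), ← mul_assoc,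
        ← mul_inv, Real.mul_self_sqrt hm0.le, div_eq_inv_mul]
    rw [mul_assoc, h1, min_def]
    split_ifs with h
    · rw [abs_of_nonpos (sub_nonpos.2 h)]
      ring
    · rw [abs_of_pos (sub_pos.2 (not_le.1 h))]
      ring
  simp only [e, multinomialMean_sub, multinomialMean_add, multinomialMean_const_mul,
    multinomialMean_div_sub hm, multinomialMean_const]
  field_simp
  ring

theorem min_sub_sq_le (a b c : ℝ) : (a ⊓ b - c) ^ 2 ≤ (a - c) ^ 2 + (b - c) ^ 2 := by
  rcases le_total a b with h | h
  · rw [inf_of_le_left h]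
    linarith [sq_nonneg (b - c)]
  · rw [inf_of_le_right h]
    linarith [sq_nonneg (a - c)]

/-- Makes the quadratic Taylor remainder at the minimum O(1/m), so it vanishes after multiplication
by √m. -/
theorem multinomialMean_inf_sub_sq_le {x : Fin d → ℝ} (hx : x ∈ simplex d) {m : ℕ}
    (hm : m ≠ 0) (i : Fin d) :
    multinomialMean m x (fun k => multinomialMean m x fun l =>
      ((k i : ℝ) / m ⊓ (l i : ℝ) / m - x i) ^ 2) ≤ 2 * (m : ℝ)⁻¹ := by
  refine (multinomialMean_mono hx fun k _ => multinomialMean_mono hx fun l _ =>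
    min_sub_sq_le ((k i : ℝ) / m) ((l i : ℝ) / m) (x i)).trans ?_
  simp only [multinomialMean_add, multinomialMean_const]
  linarith [multinomialMean_div_sub_sq_le hx hm i]

/-- The mean of `F` at the minimum of two independent multinomial proportions. -/
theorem tendsto_sqrt_mul_multinomialMean_inf_sub {F : (Fin d → ℝ) → ℝ}
    (hF : ContDiffOn ℝ 2 F (simplex d)) {x : Fin d → ℝ} (hx : x ∈ simplexInterior d) :
    Tendsto (fun m : ℕ => Real.sqrt m * ((multinomialMean m x fun k => multinomialMean m x fun l =>
        F ((fun i => (k i : ℝ) / m) ⊓ fun i => (l i : ℝ) / m)) - F x)) atTop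
      (𝓝 (-varianceTerm F x)) := by
  have hxS := simplexInterior_subset_simplex d hx
  have hx1 : ∀ i, x i < 1 := fun i =>
    (Finset.single_le_sum (fun j _ => (hx.1 j).le) (Finset.mem_univ i)).trans_lt hx.2
  obtain ⟨C, hC0, hC⟩ := exists_taylor_one hF hxS
  have hmain : Tendsto (fun m : ℕ => ∑ i, partialDeriv i F x * (-(1 / 2) *
      multinomialMean m x fun k => multinomialMean m x fun l =>
        |(Real.sqrt m)⁻¹ * ((k i : ℝ) - l i)|)) atTop (𝓝 (-varianceTerm F x)) := by
    have e : -varianceTerm F x = ∑ i, partialDeriv i F x * (-(1 / 2) *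
        (2 * Real.sqrt (x i * (1 - x i) / Real.pi))) := by
      rw [varianceTerm, ← Finset.sum_neg_distrib]
      exact Finset.sum_congr rfl fun i _ => by ring
    rw [e]
    exact tendsto_finsetSum _ fun i _ =>
      ((tendsto_multinomialMean_abs_sub i (hx.1 i) (hx1 i)).const_mul _).const_mul _
  have hb : Tendsto (fun m : ℕ => C * (d * 2) * (Real.sqrt m)⁻¹) atTop (𝓝 0) := by
    simpa using tendsto_inv_sqrt_nat.const_mul (C * (d * 2))
  refine tendsto_of_tendsto_of_dist hmain (squeeze_zero' (Eventually.of_forall fun _ => dist_nonneg)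
    ?_ hb)
  filter_upwards [eventually_ne_atTop 0] with m hm
  rw [dist_comm, Real.dist_eq]
  have h := abs_multinomialMean_le hxS fun k hk => abs_multinomialMean_le hxS fun l hl =>
    hC _ (inf_mem_simplex (div_mem_simplex (m := m) hk) (div_mem_simplex (m := m) hl))
  simp only [Pi.inf_apply, multinomialMean_sub m x, multinomialMean_const, multinomialMean_sum,
    multinomialMean_const_mul, mul_comm _ (partialDeriv _ _ x)] at h
  have h2 := Finset.sum_le_sum fun (i : Fin d) (_ : i ∈ Finset.univ) =>
    multinomialMean_inf_sub_sq_le hxS hm i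
  simp only [Finset.sum_const, Finset.card_univ, Fintype.card_fin, nsmul_eq_mul] at h2
  have h3 := mul_le_mul_of_nonneg_left (h.trans (mul_le_mul_of_nonneg_left h2 hC0))
    (Real.sqrt_nonneg m)
  rw [← abs_of_nonneg (Real.sqrt_nonneg m), ← abs_mul, abs_of_nonneg (Real.sqrt_nonneg m)] at h3
  simp only [← multinomialMean_inf_sub hm, multinomialMean_sub m x, multinomialMean_const]
  refine (le_of_eq ?_).trans (h3.trans_eq ?_)
  · simp only [mul_sub, Finset.mul_sum]
    congr 2
    exact Finset.sum_congr rfl fun i _ => by ring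
  · rw [← sqrt_mul_inv_nat]
    ring

end BernsteinSimplex
end

/-! ### Assembly of the bias and variance expansions. -/

open BernsteinSimplex in
theorem mainTheorem4 {d : ℕ} {Ω : Type*} [MeasurableSpace Ω]
    (P : Measure Ω) [IsProbabilityMeasure P]
    (μ : Measure (Fin d → ℝ)) [IsProbabilityMeasure μ]
    (hF : ContDiffOn ℝ 2 (BernsteinSimplex.jointCDF μ) (BernsteinSimplex.simplex d))
    (X : ℕ → Ω → Fin d → ℝ) (hlaw : ∀ i, HasLaw (X i) μ P) (hindep : iIndepFun X P)
    (m : ℕ → ℕ) (hm : Tendsto m atTop atTop) :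
    (∀ ε : ℝ, 0 < ε → ∀ᶠ n : ℕ in atTop, ∀ x ∈ BernsteinSimplex.simplex d,
      |((∫ ω, BernsteinSimplex.bernsteinEstimator X n (m n) x ω ∂P)
            - BernsteinSimplex.jointCDF μ x)
          - (m n : ℝ)⁻¹ * BernsteinSimplex.biasTerm (BernsteinSimplex.jointCDF μ) x|
        ≤ ε * (m n : ℝ)⁻¹) ∧
    (∀ x ∈ BernsteinSimplex.simplexInterior d,
      (fun n : ℕ =>
        variance (BernsteinSimplex.bernsteinEstimator X n (m n) x) P
          - ((n : ℝ)⁻¹ * (BernsteinSimplex.jointCDF μ x * (1 - BernsteinSimplex.jointCDF μ x))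
            - (n : ℝ)⁻¹ * (Real.sqrt (m n))⁻¹ *
              BernsteinSimplex.varianceTerm (BernsteinSimplex.jointCDF μ) x))
        =o[atTop] fun n : ℕ => (n : ℝ)⁻¹ * (Real.sqrt (m n))⁻¹) := by
  refine ⟨fun ε hε => ?_, fun x hx => ?_⟩
  · filter_upwards [hm.eventually (eventually_abs_bernsteinPolynomial_sub_le hF hε),
      eventually_ne_atTop 0] with n h hn x hx
    rw [integral_bernsteinEstimator hlaw hn]
    exact h x hx
  · have hxS := simplexInterior_subset_simplex d hx
    have h1 := tendsto_sqrt_mul_multinomialMean_inf_sub hF hx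
    have h2 := tendsto_sqrt_mul_bernsteinPolynomial_sub hF hxS
    -- Prepares the factorisation b² − F² = (b − F)(b + F), with b the Bernstein polynomial: the
    -- first factor is o(m^(-1/2)), the second converges.
    have h3 : Tendsto (fun m : ℕ => bernsteinPolynomial m (jointCDF μ) x + jointCDF μ x) atTop
        (𝓝 (jointCDF μ x + jointCDF μ x)) := by
      have h4 := h2.mul tendsto_inv_sqrt_nat
      rw [zero_mul] at h4
      have h5 : Tendsto (fun m : ℕ => bernsteinPolynomial m (jointCDF μ) x - jointCDF μ x) atTop
          (𝓝 0) := by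
        refine h4.congr' ?_
        filter_upwards [eventually_ne_atTop 0] with m hm
        have : Real.sqrt m ≠ 0 := (Real.sqrt_pos.2 (by positivity)).ne'
        field_simp
      simpa using (h5.add_const (jointCDF μ x)).add_const (jointCDF μ x)
    have h6 := (((h1.sub (h2.mul h3)).add_const
      (varianceTerm (jointCDF μ) x)).comp hm)
    rw [zero_mul, sub_zero, neg_add_cancel] at h6
    -- The convergence `h6` is the variance error divided by n⁻¹ m^(-1/2); multiplying back gives
    -- the little-o.
    have h7 := (isBigO_refl (fun n : ℕ => (n : ℝ)⁻¹ * (Real.sqrt (m n))⁻¹) atTop).mul_isLittleO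
      ((isLittleO_one_iff ℝ).2 h6)
    refine h7.congr' ?_ (Eventually.of_forall fun n => mul_one _)
    filter_upwards [eventually_ne_atTop 0, hm.eventually (eventually_ne_atTop 0)] with n hn hmn
    have : Real.sqrt (m n) ≠ 0 := (Real.sqrt_pos.2 (by positivity)).ne'
    have hn' : (n : ℝ) ≠ 0 := Nat.cast_ne_zero.2 hn
    rw [variance_bernsteinEstimator hlaw hindep hn]
    simp only [Function.comp_apply]
    field_simp
    ring
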